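/- **Setting.** Let $X_j(t)$, $t\in[0,1]$, $j\in\mathbb N=\{1,2,\dots\}$, be zero-mean (square-integrable, real) random processes with continuous covariance functions $\mathcal K^{X_j}(t,s)$. For every $d\in\mathbb N$ let $Y_d(t)$, $t\in[0,1]^d$, be a zero-mean (jointly measurable) random field with covariance function $$\mathcal K^{Y_d}(t,s)=\sum_{j=1}^d \mathcal K^{X_j}(t_j,s_j),$$ considered as a random element of $L_2([0,1]^d)$ with scalar product $(\cdot,\cdot)$ and norm $\|\cdot\|$. For $\varepsilon\in(0,1)$ its average case approximation complexity is $$n^{Y_d}(\varepsilon)=\min\{n\in\mathbb N:\ e^{Y_d}(n)\le \varepsilon\, e^{Y_d}(0)\},$$ where $$e^{Y_d}(n)=\inf\Bigl\{\Bigl(\mathbb E\bigl\|Y_d-\sum_{m=1}^n (Y_d,\psi_m)\psi_m\bigr\|^2\Bigr)^{1/2}:\ \psi_1,\dots,\psi_n\in L_2([0,1]^d)\Bigr\},\qquad e^{Y_d}(0)=\bigl(\mathbb E\|Y_d\|^2\bigr)^{1/2}.$$ Let $K^{X_j}$ be the integral operator on $L_2([0,1])$ with kernel $\mathcal K^{X_j}$,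 and let $\Lambda^{X_j}$ be its trace, i.e. the sum of its eigenvalues counted with multiplicity. Suppose that, for every $j$, the constant function $1$ is an eigenvector of $K^{X_j}$, with eigenvalue $\tilde\lambda^{X_j}_0$; let $\tilde\lambda^{X_j}_1\ge\tilde\lambda^{X_j}_2\ge\dots$ be the remaining eigenvalues, i.e. those with eigenvectors orthogonal to $1$, counted with multiplicity (continued by zeros if $K^{X_j}$ has finite rank), and put $\tilde\Lambda^{X_j}=\sum_{k\ge1}\tilde\lambda^{X_j}_k$. For a function $f$ on $\mathbb R$ let $f^{-1}(y)=\inf\{x\in\mathbb R: f(x)\ge y\}$. A distribution function is a non-decreasing right-continuous function on $\mathbb R$ with limits $0$ at $-\infty$ and $1$ at $+\infty$. Write $\mathbf 1(A)$ for the indicator of $A$, and $W(x-0)$ for the left limit of $W$ at $x$. **Theorem.** Suppose that there is $\varepsilon_0\in(0,1]$ with $$\lim_{d\to\infty}\frac{\sum_{j=1}^d\tilde\lambda^{X_j}_0}{\sum_{j=1}^d\Lambda^{X_j}}=1-\varepsilon_0^2,$$ and that $$\max_{j=1,\dots,d}\tilde\lambda^{X_j}_1=o\Bigl(\sum_{j=1}^d\tilde\Lambda^{X_j}\Bigr),\qquad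 d\to\infty.$$ Suppose that, with a distribution function $U$ and a monotonic real sequence $(\ell_j)_{j\in\mathbb N}$, at every continuity point $x$ of $U$ $$\frac1{\tilde\Lambda^{X_j}}\sum_{k=1}^\infty\tilde\lambda^{X_j}_k\,\mathbf 1\bigl(-\ln\tilde\lambda^{X_j}_k-\ell_j\le x\bigr)\to U(x),\qquad j\to\infty.$$ Let $s=1$ if $(\ell_j)$ is non-decreasing and $s=-1$ if $(\ell_j)$ is non-increasing (either choice is allowed if it is constant). Suppose that, with a distribution function $W$, a real sequence $(a_d)$ and a positive sequence $(b_d)$ with $b_d\to\infty$, at every continuity point $x$ of $W$ $$\frac{\sum_{j=1}^d\tilde\Lambda^{X_j}\,\mathbf 1\bigl(s(\ell_j-a_d)\le x b_d\bigr)}{\sum_{m=1}^d\tilde\Lambda^{X_m}}\to W(x),\qquad d\to\infty.$$ Put $F(x)=W(x)$ if $s=1$, and $F(x)=1-W((-x)-0)$ if $s=-1$, $x\in\mathbb R$. Then, for every $\varepsilon\in(0,\varepsilon_0)$ such that $1-(\varepsilon/\varepsilon_0)^2$ is a continuity point of $F^{-1}$, $$\ln n^{Y_d}(\varepsilon)=\ln\Bigl(\sum_{j=1}^d\tilde\Lambda^{X_j}\Bigr)+a_d+F^{-1}\bigl(1-(\varepsilon/\varepsilon_0)^2\bigr)\,b_d+o(b_d),\qquad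 d\to\infty.$$ -/

import Mathlib

open MeasureTheory ProbabilityTheory Filter Topology Asymptotics
open scoped ENNReal

noncomputable section

namespace AdditiveField

/-- A zero-mean real random function `Z` on `T`, with square-integrable values, over the probability
space `(Ω, P)`. -/
structure IsCentered {T Ω : Type*} [MeasurableSpace Ω] (P : Measure Ω) (Z : T → Ω → ℝ) :
    Prop where
  memLp : ∀ t, MemLp (Z t) 2 P
  mean_zero : ∀ t, ∫ ω, Z t ω ∂P = 0

/-- The covariance function of a random function. -/
def covFun {T Ω : Type*} [MeasurableSpace Ω] (P : Measure Ω) (Z : T → Ω → ℝ) (t s : T) : ℝ :=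
  cov[Z t, Z s; P]

/-! ### Eigenvalues of integral operators -/

section Eigen

variable {T : Type*} [MeasureSpace T]

/-- The integral operator with kernel `C`. -/
def integralOp (C : T → T → ℝ) (f : T → ℝ) (t : T) : ℝ := ∫ s, C t s * f s

/-- `f` satisfies the eigenvalue equation `K f = v f` in `L₂(T)`, where `K` is the integral operator
with kernel `C`. -/
def EigenEq (C : T → T → ℝ) (v : ℝ) (f : T → ℝ) : Prop :=
  integralOp C f =ᵐ[volume] fun t => v * f t

/-- The non-increasing sequence of the eigenvalues, counted with multiplicity, of the integral
operator with kernel `C`, indexed from `0`: the entry of index `k` is the largest `v` such that there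
are `k + 1` orthonormal eigenvectors whose eigenvalues are all at least `v`. If a positive
semidefinite operator has finite rank `p`, then the entries of index `p, p + 1, …` are `0`. -/
def eigenvalue (C : T → T → ℝ) (k : ℕ) : ℝ :=
  sSup {v : ℝ | ∃ φ : Fin (k + 1) → Lp ℝ 2 (volume : Measure T), Orthonormal ℝ φ ∧
    ∀ i, ∃ w : ℝ, v ≤ w ∧ EigenEq C w (φ i)}

/-- The trace: the sum of all eigenvalues. -/
def trace (C : T → T → ℝ) : ℝ := ∑' k, eigenvalue C k

/-- When the constant function `1` is an eigenvector: the non-increasing sequence of the remaining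
eigenvalues, counted with multiplicity and indexed from `0`, that is, the eigenvalues that belong to
eigenvectors orthogonal to `1`. -/
def remEigenvalue (C : T → T → ℝ) (k : ℕ) : ℝ :=
  sSup {v : ℝ | ∃ φ : Fin (k + 1) → Lp ℝ 2 (volume : Measure T), Orthonormal ℝ φ ∧
    ∀ i, ∫ t, φ i t = 0 ∧ ∃ w : ℝ, v ≤ w ∧ EigenEq C w (φ i)}

/-- The sum of the remaining eigenvalues. -/
def remTrace (C : T → T → ℝ) : ℝ := ∑' k, remEigenvalue C k

end Eigen

/-! ### Average case approximation complexity -/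

section Complexity

variable {T Ω : Type*} [MeasureSpace T] [MeasurableSpace Ω]

/-- The rank-`n` linear algorithm `∑ₘ (z, ψₘ) ψₘ`, applied to a function `z`. -/
def rankApprox {n : ℕ} (ψ : Fin n → Lp ℝ 2 (volume : Measure T)) (z : T → ℝ) (t : T) : ℝ :=
  ∑ m, (∫ s, z s * ψ m s) * ψ m t

/-- The smallest 2-average error `inf (E ‖Z - ∑ₘ (Z, ψₘ) ψₘ‖²)^(1/2)` over all
`ψ₁, …, ψₙ ∈ L₂(T)`; for `n = 0` it is `(E ‖Z‖²)^(1/2)`. -/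
def approxError (P : Measure Ω) (Z : T → Ω → ℝ) (n : ℕ) : ℝ≥0∞ :=
  ⨅ ψ : Fin n → Lp ℝ 2 (volume : Measure T),
    (∫⁻ ω, ∫⁻ t, ‖Z t ω - rankApprox ψ (fun s => Z s ω) t‖ₑ ^ 2 ∂volume ∂P) ^ (1 / 2 : ℝ)

/-- The average case approximation complexity: the least positive integer `n` such that the smallest
2-average error of rank `n` is at most `ε` times the error of the zero approximation. -/
def approxComplexity (P : Measure Ω) (Z : T → Ω → ℝ) (ε : ℝ) : ℕ :=
  sInf {n : ℕ | 1 ≤ n ∧ approxError P Z n ≤ ENNReal.ofReal ε * approxError P Z 0}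

end Complexity

/-! ### Distribution functions -/

/-- Distribution functions on the real line. -/
structure IsDistFun (F : ℝ → ℝ) : Prop where
  mono : Monotone F
  right_cont : ∀ x, ContinuousWithinAt F (Set.Ici x) x
  tendsto_bot : Tendsto F atBot (𝓝 0)
  tendsto_top : Tendsto F atTop (𝓝 1)

/-- The generalized inverse `F⁻¹(y) = inf {x : F(x) ≥ y}`. -/
def genInv (F : ℝ → ℝ) (y : ℝ) : ℝ := sInf {x : ℝ | y ≤ F x}

/-- `W` itself if `sgn = 1`, and `x ↦ 1 - W((-x) - 0)` if `sgn = -1`: the distribution function of `sgn V`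
when `V` has distribution function `W`. -/
def signedDist (sgn : ℝ) (W : ℝ → ℝ) (x : ℝ) : ℝ :=
  if sgn = 1 then W x else 1 - Function.leftLim W (-x)

end AdditiveField

end

/-! The covariance operator of `Y_d` can be diagonalized explicitly. If `φ` is an eigenvector of the
`j`-th marginal operator orthogonal to `1`, then `t ↦ φ(t_j)` is an eigenvector for `Y_d` with the
same eigenvalue. Such functions for different `j` are orthogonal to each other and to constants, and
all the constants merge into the single eigenvalue `∑ r_j`, where `r_j` is the `j`-th eigenvalue of
`1`. So the spectrum is the union of the remaining marginal spectra plus one number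
(`fieldSpectrum_additive`).

The squared error of rank `n` is the trace minus the variance captured by at most `n` orthonormal
vectors. Let `L` be the sum of all remaining eigenvalues and `S(θ)` the sum of those that are at
least `θ`. Keeping these and the constant costs at most `2 S(θ)/θ` dimensions. Conversely, `n`
dimensions capture at most `∑ r_j + S(θ') + n θ'`, for any `θ'` (`approxComplexity_bounds`). Since
`L` over the trace tends to `ε₀²`, the admissible squared error is asymptotically `(ε/ε₀)² L`, so
the critical threshold is where `S(θ)/L` crosses `y = 1 - (ε/ε₀)²`.

With `θ = e^{-t}`, `S(θ)/L` is the mass of `{-ln λ ≤ t}` when each eigenvalue `λ` has weight `λ/L`.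
Inside block `j`, `-ln λ` stays within a bounded distance of `ℓ_j` up to small mass, because the
limit `U` is a proper distribution. As `b_d → ∞`, this spread is invisible on the scale `b_d`; hence
the shape of `U` does not enter the answer. What remains is the weighted distribution of `ℓ_j`,
which is `F` after centering by `a_d` and scaling by `b_d`. So `t = a_d + F⁻¹(y) b_d + o(b_d)` and
`ln n = ln L + t + o(b_d)`, the constant factors being absorbed by `b_d`
(`isLittleO_log_complexity`). Finitely many initial blocks are negligible because `L → ∞`
(`tendsto_sum_atTop_of_isLittleO`). -/

namespace AdditiveField

/-! ### Spectral decomposition of compact symmetric operators -/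

section Spectral

universe u

variable {H : Type*} [NormedAddCommGroup H] [InnerProductSpace ℝ H]

open scoped InnerProductSpace

/-- Hilbert bases of the eigenspaces, the kernel included, are glued together; the spectral theorem
for compact symmetric operators says that nothing is orthogonal to all eigenspaces. -/
theorem exists_eigenbasis {H : Type u} [NormedAddCommGroup H] [InnerProductSpace ℝ H]
    [CompleteSpace H] (K : H →L[ℝ] H) (hc : IsCompactOperator K)
    (hs : (K : H →ₗ[ℝ] H).IsSymmetric) :
    ∃ (ι : Type u) (b : HilbertBasis ι ℝ H) (μ : ι → ℝ), ∀ i, K (b i) = μ i • b i := by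
  let E : ℝ → Submodule ℝ H := fun μ => Module.End.eigenspace (K : H →ₗ[ℝ] H) μ
  have hmem : ∀ μ x, x ∈ E μ ↔ K x = μ • x := fun μ x => Module.End.mem_eigenspace_iff
  have hE : ∀ μ, CompleteSpace (E μ) := fun μ => by
    have : IsClosed (E μ : Set H) := by
      have h : (E μ : Set H) = {x | K x = μ • x} := Set.ext (hmem μ)
      rw [h]
      exact isClosed_eq K.continuous (continuous_const_smul μ)
    exact this.completeSpace_coe
  have hex : ∀ μ, ∃ w : Set (E μ), Nonempty (HilbertBasis w ℝ (E μ)) := fun μ =>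
    let ⟨w, b, _⟩ := exists_hilbertBasis ℝ (E μ)
    ⟨w, ⟨b⟩⟩
  choose w b using hex
  have b : ∀ μ, HilbertBasis (w μ) ℝ (E μ) := fun μ => (b μ).some
  have ho : Orthonormal ℝ fun a : Σ μ, w μ => ((b a.1 a.2 : E a.1) : H) :=
    hs.orthogonalFamily_eigenspaces.orthonormal_sigma_orthonormal (fun μ => (b μ).orthonormal)
  have hbot : (Submodule.span ℝ (Set.range fun a : Σ μ, w μ => ((b a.1 a.2 : E a.1) : H)))ᗮ
      = ⊥ := by
    rw [eq_bot_iff, ← ContinuousLinearMap.orthogonalComplement_iSup_eigenspaces_eq_bot hc hs]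
    intro x hx
    rw [Submodule.mem_orthogonal] at hx
    rw [Submodule.mem_orthogonal']
    intro u hu
    rw [real_inner_comm]
    -- The basis vectors span only a dense subspace of `E μ`, since the kernel may be
    -- infinite-dimensional, so orthogonality is extended by closedness.
    have key : ∀ μ, ∀ u ∈ E μ, ⟪u, x⟫_ℝ = 0 := by
      intro μ u hu
      have hcl : IsClosed {u : E μ | ⟪(u : H), x⟫_ℝ = 0} :=
        isClosed_eq (by fun_prop) continuous_const
      have hsub : (Submodule.span ℝ (Set.range (b μ)) : Set (E μ)) ⊆
          {u : E μ | ⟪(u : H), x⟫_ℝ = 0} := by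
        intro v hv
        induction hv using Submodule.span_induction with
        | mem v hv =>
          obtain ⟨i, rfl⟩ := hv
          exact hx _ (Submodule.subset_span ⟨⟨μ, i⟩, rfl⟩)
        | zero => simp
        | add a c _ _ ha hc =>
          have ha : ⟪(a : H), x⟫_ℝ = 0 := ha
          have hc : ⟪(c : H), x⟫_ℝ = 0 := hc
          simp [inner_add_left, ha, hc]
        | smul r a _ ha =>
          have ha : ⟪(a : H), x⟫_ℝ = 0 := ha
          simp [inner_smul_left, ha]
      have hu' : (⟨u, hu⟩ : E μ) ∈
          (Submodule.span ℝ (Set.range (b μ))).topologicalClosure := by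
        rw [(b μ).dense_span]; trivial
      exact closure_minimal hsub hcl hu'
    induction hu using Submodule.iSup_induction' with
    | mem μ u hu => exact key μ u hu
    | zero => simp
    | add a c _ _ ha hc => simp [inner_add_left, ha, hc]
  refine ⟨_, HilbertBasis.mkOfOrthogonalEqBot ho hbot, fun a => a.1, fun a => ?_⟩
  rw [HilbertBasis.coe_mkOfOrthogonalEqBot]
  exact (hmem _ _).1 (b a.1 a.2).2

/-- `φ` is an orthonormal family of eigenvectors of `K`, with eigenvalues `μ`, that diagonalizes
`K`. -/
structure Diagonalizes {A : Type*} (K : H →L[ℝ] H) (φ : A → H) (μ : A → ℝ) : Prop where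
  orthonormal : Orthonormal ℝ φ
  pos : ∀ i, 0 < μ i
  summable : Summable μ
  hasSum : ∀ f, HasSum (fun i => (μ i * ⟪φ i, f⟫_ℝ) • φ i) (K f)

namespace Diagonalizes

variable {A : Type*} {K : H →L[ℝ] H} {φ : A → H} {μ : A → ℝ}

theorem inner_apply (h : Diagonalizes K φ μ) (i : A) (f : H) :
    ⟪φ i, K f⟫_ℝ = μ i * ⟪φ i, f⟫_ℝ := by
  classical
  have h1 := (innerSL ℝ (φ i)).hasSum (h.hasSum f)
  have h2 : (fun j => (innerSL ℝ (φ i)) ((μ j * ⟪φ j, f⟫_ℝ) • φ j)) =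
      fun j => if j = i then μ i * ⟪φ i, f⟫_ℝ else 0 := by
    ext j
    rw [innerSL_apply_apply, inner_smul_right, orthonormal_iff_ite.1 h.orthonormal i j]
    by_cases hij : i = j
    · subst hij; simp
    · simp [hij, Ne.symm hij]
  rw [h2] at h1
  exact h1.unique (hasSum_ite_eq i (μ i * ⟪φ i, f⟫_ℝ))

theorem apply_eq (h : Diagonalizes K φ μ) (i : A) : K (φ i) = μ i • φ i := by
  classical
  refine (h.hasSum (φ i)).unique ?_
  convert hasSum_ite_eq i (μ i • φ i) using 2 with j
  rw [orthonormal_iff_ite.1 h.orthonormal j i]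
  split_ifs with hij
  · subst hij; simp
  · simp

theorem hasSum_inner (h : Diagonalizes K φ μ) (f : H) :
    HasSum (fun i => μ i * ⟪φ i, f⟫_ℝ ^ 2) ⟪K f, f⟫_ℝ := by
  have h1 := (innerSL ℝ f).hasSum (h.hasSum f)
  rw [real_inner_comm]
  refine h1.congr_fun fun i => ?_
  simp only [innerSL_apply_apply, inner_smul_right, real_inner_comm (φ i) f]
  ring

theorem finite (h : Diagonalizes K φ μ) {v : ℝ} (hv : 0 < v) : {i | v ≤ μ i}.Finite := by
  have := h.summable.tendsto_cofinite_zero.eventually (gt_mem_nhds hv)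
  rw [Filter.eventually_cofinite] at this
  simpa using this

/-- For positive `v` there are `k` orthonormal eigenvectors with eigenvalues at least `v` if and
only if `k` of the numbers `μ i` are at least `v`. -/
theorem exists_orthonormal_iff (h : Diagonalizes K φ μ) {v : ℝ} (hv : 0 < v) (k : ℕ) :
    (∃ ψ : Fin k → H, Orthonormal ℝ ψ ∧ ∀ i, ∃ w, v ≤ w ∧ K (ψ i) = w • ψ i) ↔
      k ≤ {i | v ≤ μ i}.ncard := by
  classical
  have hf := h.finite hv
  constructor
  · rintro ⟨ψ, ho, hψ⟩
    -- An eigenvector for `w ≥ v` is orthogonal to every `φ a` with `μ a ≠ w`. As `w > 0`, it is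
    -- recovered from its image `K (ψ i)`, hence lies in the span, and a dimension count finishes.
    have hmem : ∀ i, ψ i ∈ Submodule.span ℝ (φ '' {i | v ≤ μ i}) := by
      intro i
      obtain ⟨w, hw, hK⟩ := hψ i
      have hw0 : 0 < w := hv.trans_le hw
      have hz : ∀ a ∉ hf.toFinset, (μ a * ⟪φ a, ψ i⟫_ℝ) • φ a = 0 := by
        intro a ha
        have ha' : ¬ v ≤ μ a := by simpa using ha
        have h1 := h.inner_apply a (ψ i)
        rw [hK, inner_smul_right] at h1
        have h2 : (w - μ a) * ⟪φ a, ψ i⟫_ℝ = 0 := by linarith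
        rcases mul_eq_zero.1 h2 with h3 | h3
        · exact absurd (hw.trans_eq (by linarith)) ha'
        · simp [h3]
      have h1 := (h.hasSum (ψ i)).unique (hasSum_sum_of_ne_finset_zero hz)
      have h2 : ψ i = w⁻¹ • K (ψ i) := by rw [hK, smul_smul, inv_mul_cancel₀ hw0.ne', one_smul]
      rw [h2, h1]
      refine Submodule.smul_mem _ _ (Submodule.sum_mem _ fun a ha => Submodule.smul_mem _ _
        (Submodule.subset_span ⟨a, by simpa using ha, rfl⟩))
    have hfin : (φ '' {i | v ≤ μ i}).Finite := hf.image _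
    have := hfin.fintype
    have hfd : FiniteDimensional ℝ (Submodule.span ℝ (φ '' {i | v ≤ μ i})) :=
      FiniteDimensional.span_of_finite ℝ hfin
    let ψ' : Fin k → Submodule.span ℝ (φ '' {i | v ≤ μ i}) := fun i => ⟨ψ i, hmem i⟩
    have hli : LinearIndependent ℝ ψ' := by
      refine LinearIndependent.of_comp (Submodule.subtype _) ?_
      exact ho.linearIndependent
    have h1 := hli.fintype_card_le_finrank
    have h2 := finrank_span_le_card (R := ℝ) (φ '' {i | v ≤ μ i})
    rw [← Set.ncard_eq_toFinset_card'] at h2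
    rw [Fintype.card_fin] at h1
    exact h1.trans (h2.trans (Set.ncard_image_le hf))
  · intro hk
    rw [Set.ncard_eq_toFinset_card _ hf] at hk
    obtain ⟨F, hF, hcard⟩ := Finset.exists_subset_card_eq hk
    let e : Fin k ≃ F := (finCongr hcard.symm).trans F.equivFin.symm
    refine ⟨fun i => φ (e i), h.orthonormal.comp _ (Subtype.val_injective.comp e.injective),
      fun i => ⟨μ (e i), by simpa using hF (e i).2, h.apply_eq _⟩⟩

end Diagonalizes

end Spectral

/-! ### Enumeration in non-increasing order -/

section Enumeration

variable {A : Type*} {μ : A → ℝ} {S : ℕ → Set ℝ}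

/-- The number `v` belongs to `S k` if and only if more than `k` of the numbers `μ i` are at
least `v`. -/
structure Enumerates (S : ℕ → Set ℝ) (μ : A → ℝ) : Prop where
  pos : ∀ i, 0 < μ i
  finite : ∀ v, 0 < v → {i | v ≤ μ i}.Finite
  mem_iff : ∀ k v, 0 < v → (v ∈ S k ↔ k + 1 ≤ {i | v ≤ μ i}.ncard)
  nonneg_mem : ∀ k v, v ∈ S k → ∃ u ∈ S k, 0 ≤ u

namespace Enumerates

theorem bddAbove (h : Enumerates S μ) (k : ℕ) : BddAbove (S k) := by
  obtain ⟨M, hM⟩ := ((h.finite 1 one_pos).image μ).bddAbove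
  refine ⟨max M 1, fun v hv => ?_⟩
  by_contra! hlt
  have hv0 : 0 < v := one_pos.trans ((le_max_right M 1).trans_lt hlt)
  have h1 := (h.mem_iff k v hv0).1 hv
  have h2 : {i | v ≤ μ i}.Nonempty := by
    rw [← Set.ncard_pos (h.finite v hv0)]; omega
  obtain ⟨i, hi⟩ := h2
  have hi : v ≤ μ i := hi
  have h3 : 1 ≤ μ i := ((le_max_right M 1).trans_lt hlt).le.trans hi
  have h4 := hM ⟨i, h3, rfl⟩
  linarith [le_max_left M 1]

/-- An empty `S k` has `sSup` equal to the default value `0`, which is exactly the padding by zeros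
wanted here; otherwise `nonneg_mem` excludes a negative supremum. -/
theorem sSup_nonneg (h : Enumerates S μ) (k : ℕ) : 0 ≤ sSup (S k) := by
  rcases (S k).eq_empty_or_nonempty with he | ⟨v, hv⟩
  · simp [he]
  · obtain ⟨u, hu, hu0⟩ := h.nonneg_mem k v hv
    exact hu0.trans (le_csSup (h.bddAbove k) hu)

/-- The supremum is attained at positive levels: only finitely many `μ i` exceed `v / 2`, so some
`v' < v` has no `μ i` in `[v', v)`, and the counts at `v'` and `v` agree. -/
theorem le_sSup_iff (h : Enumerates S μ) (k : ℕ) {v : ℝ} (hv : 0 < v) :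
    v ≤ sSup (S k) ↔ k + 1 ≤ {i | v ≤ μ i}.ncard := by
  constructor
  · intro hle
    have hfin := h.finite (v / 2) (half_pos hv)
    obtain ⟨v', hv'1, hv'2, hv'3⟩ : ∃ v', v / 2 ≤ v' ∧ v' < v ∧ ∀ i, v' ≤ μ i → v ≤ μ i := by
      have hB := (hfin.subset (Set.sep_subset _ fun i => μ i < v)).image μ
      obtain ⟨v', hv', hv'2, hv'3⟩ : ∃ v', v / 2 ≤ v' ∧ v' < v ∧
          ∀ x ∈ μ '' {i ∈ {i | v / 2 ≤ μ i} | μ i < v}, x < v' := by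
        rcases (μ '' {i ∈ {i | v / 2 ≤ μ i} | μ i < v}).eq_empty_or_nonempty with he | hne
        · exact ⟨v / 2, le_rfl, half_lt_self hv, by rw [he]; exact fun x hx => hx.elim⟩
        · obtain ⟨m, ⟨i, hi, rfl⟩, hmax⟩ := Set.exists_max_image _ id hB hne
          obtain ⟨v', h1, h2⟩ := exists_between hi.2
          exact ⟨v', (show v / 2 ≤ μ i from hi.1).trans h1.le, h2,
            fun x hx => (hmax x hx).trans_lt h1⟩
      refine ⟨v', hv', hv'2, fun i hi => ?_⟩
      by_contra! hlt
      exact absurd (hv'3 _ ⟨i, ⟨hv'.trans hi, hlt⟩, rfl⟩) (not_lt.2 hi)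
    have hne : (S k).Nonempty := by
      by_contra hne
      rw [Set.not_nonempty_iff_eq_empty] at hne
      rw [hne, Real.sSup_empty] at hle
      exact absurd hv (not_lt.2 hle)
    obtain ⟨u, hu, hlt⟩ := exists_lt_of_lt_csSup hne (hv'2.trans_le hle)
    have hv'0 : 0 < v' := (half_pos hv).trans_le hv'1
    refine ((h.mem_iff k u (hv'0.trans hlt)).1 hu).trans
      (Set.ncard_le_ncard (fun i hi => hv'3 i (hlt.le.trans hi)) (h.finite v hv))
  · intro hk
    exact le_csSup (h.bddAbove k) ((h.mem_iff k v hv).2 hk)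

theorem antitone (h : Enumerates S μ) : Antitone fun k => sSup (S k) := by
  intro k m hkm
  rcases (h.sSup_nonneg m).eq_or_lt with h0 | h0
  · exact h0.symm.trans_le (h.sSup_nonneg k)
  · have := (h.le_sSup_iff m h0).1 le_rfl
    exact (h.le_sSup_iff k h0).2 (by omega)

/-- By `le_sSup_iff` both families have equally many members above every positive level. The
multiplicity of `v` is the difference of the counts at `v` and at a level `u` so close above it that
no value lies strictly between. -/
theorem ncard_fiber (h : Enumerates S μ) {v : ℝ} (hv : 0 < v) :
    {k | sSup (S k) = v}.Finite ∧ {k | sSup (S k) = v}.ncard = {i | μ i = v}.ncard := by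
  have hle : ∀ u, 0 < u → {k | u ≤ sSup (S k)} = Set.Iio {i | u ≤ μ i}.ncard := by
    intro u hu
    ext k
    simp only [Set.mem_ofPred_eq, Set.mem_Iio]
    rw [h.le_sSup_iff k hu]
    omega
  have hfin := h.finite v hv
  have hfk : {k | v ≤ sSup (S k)}.Finite := by rw [hle v hv]; exact Set.finite_Iio _
  obtain ⟨u, hvu, hu1, hu2⟩ : ∃ u, v < u ∧ (∀ i, v < μ i → u ≤ μ i) ∧
      ∀ k, v < sSup (S k) → u ≤ sSup (S k) := by
    have hB : (μ '' {i | v ≤ μ i} ∪ (fun k => sSup (S k)) '' {k | v ≤ sSup (S k)}).Finite :=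
      (hfin.image _).union (hfk.image _)
    have hB' := hB.subset (Set.sep_subset _ fun x => v < x)
    rcases Set.eq_empty_or_nonempty
      {x ∈ μ '' {i | v ≤ μ i} ∪ (fun k => sSup (S k)) '' {k | v ≤ sSup (S k)} | v < x}
      with he | hne
    · refine ⟨v + 1, by linarith, fun i hi => ?_, fun k hk => ?_⟩
      · have : μ i ∈ (∅ : Set ℝ) := he ▸ ⟨Or.inl ⟨i, hi.le, rfl⟩, hi⟩
        exact this.elim
      · have : sSup (S k) ∈ (∅ : Set ℝ) := he ▸ ⟨Or.inr ⟨k, hk.le, rfl⟩, hk⟩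
        exact this.elim
    · obtain ⟨m, hm, hmin⟩ := Set.exists_min_image _ id hB' hne
      exact ⟨m, hm.2, fun i hi => hmin _ ⟨Or.inl ⟨i, hi.le, rfl⟩, hi⟩,
        fun k hk => hmin _ ⟨Or.inr ⟨k, hk.le, rfl⟩, hk⟩⟩
  have hu : 0 < u := hv.trans hvu
  have e1 : {k | sSup (S k) = v} = {k | v ≤ sSup (S k)} \ {k | u ≤ sSup (S k)} := by
    ext k
    simp only [Set.mem_ofPred_eq, Set.mem_sdiff, not_le]
    exact ⟨fun hk => ⟨hk.ge, hk.trans_lt hvu⟩, fun hk => le_antisymm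
      (not_lt.1 fun hlt => absurd (hu2 k hlt) (not_le.2 hk.2)) hk.1⟩
  have e2 : {i | μ i = v} = {i | v ≤ μ i} \ {i | u ≤ μ i} := by
    ext i
    simp only [Set.mem_ofPred_eq, Set.mem_sdiff, not_le]
    exact ⟨fun hk => ⟨hk.ge, hk.trans_lt hvu⟩, fun hk => le_antisymm
      (not_lt.1 fun hlt => absurd (hu1 i hlt) (not_le.2 hk.2)) hk.1⟩
  refine ⟨hfk.subset (e1 ▸ Set.sdiff_subset), ?_⟩
  have s1 : {k | u ≤ sSup (S k)} ⊆ {k | v ≤ sSup (S k)} := fun k hk => hvu.le.trans hk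
  have s2 : {i | u ≤ μ i} ⊆ {i | v ≤ μ i} := fun i hi => hvu.le.trans hi
  rw [e1, e2, Set.ncard_sdiff s1 (hfk.subset s1), Set.ncard_sdiff s2 (h.finite u hu), hle v hv,
    hle u hu]
  simp [Set.ncard_eq_toFinset_card']

/-- Equal finite multiplicities allow a matching fibre by fibre. This carries sums, and later the
eigenvectors, over to the ordered sequence. -/
theorem exists_equiv (h : Enumerates S μ) :
    ∃ e : {k // 0 < sSup (S k)} ≃ A, ∀ k, μ (e k) = sSup (S k) := by
  have hex : ∀ v : {v : ℝ // 0 < v}, Nonempty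
      ({k : {k // 0 < sSup (S k)} // (⟨sSup (S k.1), k.2⟩ : {v : ℝ // 0 < v}) = v} ≃
        {i // (⟨μ i, h.pos i⟩ : {v : ℝ // 0 < v}) = v}) := by
    intro v
    obtain ⟨hf, hn⟩ := h.ncard_fiber v.2
    have hf2 : {i | μ i = v}.Finite := (h.finite v v.2).subset fun i hi => hi.ge
    have e0 : {k | sSup (S k) = v} ≃ {i | μ i = v} := by
      have := hf.fintype
      have := hf2.fintype
      refine Fintype.equivOfCardEq ?_
      rw [← Nat.card_eq_fintype_card, ← Nat.card_eq_fintype_card]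
      exact hn
    refine ⟨⟨fun k => ⟨e0 ⟨k.1.1, congrArg Subtype.val k.2⟩,
        Subtype.ext (e0 ⟨k.1.1, congrArg Subtype.val k.2⟩).2⟩,
      fun i => ⟨⟨(e0.symm ⟨i.1, congrArg Subtype.val i.2⟩).1, ?_⟩,
        Subtype.ext (e0.symm ⟨i.1, congrArg Subtype.val i.2⟩).2⟩, ?_, ?_⟩⟩
    · have := (e0.symm ⟨i.1, congrArg Subtype.val i.2⟩).2
      rw [Set.mem_ofPred_eq] at this
      rw [this]
      exact v.2
    · rintro ⟨⟨k, hk⟩, hkv⟩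
      simp
    · rintro ⟨i, hi⟩
      simp
  let E' := fun v => (hex v).some
  refine ⟨(Equiv.sigmaFiberEquiv _).symm.trans ((Equiv.sigmaCongrRight E').trans
    (Equiv.sigmaFiberEquiv fun i => (⟨μ i, h.pos i⟩ : {v : ℝ // 0 < v}))), fun k => ?_⟩
  exact congrArg Subtype.val ((E' ⟨sSup (S k.1), k.2⟩) ⟨k, rfl⟩).2

theorem hasSum_iff (h : Enumerates S μ) (g : ℝ → ℝ) (hg : g 0 = 0) (a : ℝ) :
    HasSum (fun k => g (sSup (S k))) a ↔ HasSum (fun i => g (μ i)) a := by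
  obtain ⟨e, he⟩ := h.exists_equiv
  rw [← e.hasSum_iff, ← hasSum_subtype_iff_of_support_subset (s := {k | 0 < sSup (S k)})]
  · refine Iff.of_eq (congrArg (fun f => HasSum f a) ?_)
    ext k
    simp only [Function.comp_apply]
    rw [he k]
  · intro k hk
    refine (h.sSup_nonneg k).lt_of_ne fun h0 => hk ?_
    simp only [← h0, hg]

end Enumerates

end Enumeration

/-! ### Reindexing a diagonalization and adjoining one eigenvector. -/

section

open scoped InnerProductSpace

variable {H : Type*} [NormedAddCommGroup H] [InnerProductSpace ℝ H]

theorem Diagonalizes.reindex {A B : Type*} {K : H →L[ℝ] H} {φ : A → H} {μ : A → ℝ}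
    (h : Diagonalizes K φ μ) (e : B ≃ A) : Diagonalizes K (φ ∘ e) (μ ∘ e) where
  orthonormal := h.orthonormal.comp _ e.injective
  pos _ := h.pos _
  summable := e.summable_iff.2 h.summable
  hasSum f := e.hasSum_iff.2 (h.hasSum f)

/-- Adjoining an eigenvector that is orthogonal to the others. -/
theorem Diagonalizes.sum_unit {A : Type*} {K : H →L[ℝ] H} {φ : A → H} {μ : A → ℝ}
    {e : H} {r : ℝ} (hr : 0 < r) (he : ‖e‖ = 1) (hφ : ∀ i, ⟪e, φ i⟫_ℝ = 0)
    (h : Diagonalizes (K - r • (innerSL ℝ e).smulRight e) φ μ) :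
    Diagonalizes K (Sum.elim φ fun _ : Unit => e) (Sum.elim μ fun _ => r) where
  orthonormal := by
    classical
    rw [orthonormal_iff_ite]
    rintro (i | i) (j | j)
    · simpa using orthonormal_iff_ite.1 h.orthonormal i j
    · simpa [real_inner_comm] using hφ i
    · simpa using hφ j
    · simp [he]
  pos := by rintro (i | i); exacts [h.pos i, hr]
  summable := (HasSum.sum (f := Sum.elim μ fun _ : Unit => r) h.summable.hasSum
    (hasSum_unique fun _ : Unit => r)).summable
  hasSum f := by
    have h2 := HasSum.sum (f := fun i : A ⊕ Unit => ((Sum.elim μ fun _ : Unit => r) i *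
      ⟪(Sum.elim φ fun _ : Unit => e) i, f⟫_ℝ) • (Sum.elim φ fun _ : Unit => e) i) (h.hasSum f)
      (hasSum_unique _)
    convert h2 using 1
    simp [mul_smul]

end

/-! ### Trace-class diagonalization of `D D*` for a compact Hilbert-Schmidt `D`. -/

section Gram

universe u v

open scoped InnerProductSpace

variable {H : Type u} [NormedAddCommGroup H] [InnerProductSpace ℝ H] [CompleteSpace H]
  {G : Type v} [NormedAddCommGroup G] [InnerProductSpace ℝ G] [CompleteSpace G]

/-- The operator `D D*`. -/
noncomputable def gramOp (D : G →L[ℝ] H) : H →L[ℝ] H := D.comp (ContinuousLinearMap.adjoint D)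

theorem inner_gramOp (D : G →L[ℝ] H) (f g : H) :
    ⟪gramOp D f, g⟫_ℝ = ⟪ContinuousLinearMap.adjoint D f, ContinuousLinearMap.adjoint D g⟫_ℝ := by
  rw [gramOp, ContinuousLinearMap.comp_apply, ContinuousLinearMap.adjoint_inner_right]

theorem gramOp_isSymmetric (D : G →L[ℝ] H) : (gramOp D : H →ₗ[ℝ] H).IsSymmetric := fun f g => by
  have h1 := inner_gramOp D f g
  have h2 := inner_gramOp D g f
  rw [ContinuousLinearMap.coe_coe, h1, real_inner_comm, ← h2, real_inner_comm]

/-- The square of the Hilbert-Schmidt norm of `D` is at most `M`. -/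
def HilbertSchmidtBound (D : G →L[ℝ] H) (M : ℝ) : Prop :=
  ∀ (n : ℕ) (h : Fin n → G), Orthonormal ℝ h → ∑ i, ‖D (h i)‖ ^ 2 ≤ M

/-- For unit eigenvectors `b i` with `μ i > 0`, the vectors `D* (b i) / √(μ i)` are orthonormal and
`D` maps them to `√(μ i) b i`. So the Hilbert-Schmidt bound controls the sum of the `μ i`. Kernel
vectors are discarded. -/
theorem exists_diagonalizes_gramOp (D : G →L[ℝ] H) (hc : IsCompactOperator D) {M : ℝ}
    (hM : HilbertSchmidtBound D M) :
    ∃ (A : Type u) (φ : A → H) (μ : A → ℝ), Diagonalizes (gramOp D) φ μ := by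
  classical
  obtain ⟨ι, b, μ, hb⟩ := exists_eigenbasis (gramOp D) (hc.comp_clm _) (gramOp_isSymmetric D)
  have hin : ∀ i j, ⟪ContinuousLinearMap.adjoint D (b i), ContinuousLinearMap.adjoint D (b j)⟫_ℝ
      = if i = j then μ i else 0 := by
    intro i j
    rw [← inner_gramOp, hb, inner_smul_left, orthonormal_iff_ite.1 b.orthonormal i j]
    simp
  have hμ : ∀ i, 0 ≤ μ i := fun i => by
    have := hin i i
    rw [if_pos rfl] at this
    rw [← this]
    exact real_inner_self_nonneg
  refine ⟨{i // 0 < μ i}, fun i => b i, fun i => μ i,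
    b.orthonormal.comp _ Subtype.val_injective, fun i => i.2, ?_, fun f => ?_⟩
  · refine summable_of_sum_le (c := M) (fun i => hμ _) fun F => ?_
    let e := F.equivFin.symm
    let h : Fin F.card → G := fun i =>
      (Real.sqrt (μ (e i).1))⁻¹ • ContinuousLinearMap.adjoint D (b (e i).1)
    have hpos : ∀ i, 0 < Real.sqrt (μ (e i).1) := fun i => Real.sqrt_pos.2 (e i).1.2
    have hh : Orthonormal ℝ h := by
      rw [orthonormal_iff_ite]
      intro i j
      simp only [h, inner_smul_left, inner_smul_right, hin]
      by_cases hij : i = j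
      · subst hij
        have h2 := Real.mul_self_sqrt (hμ (e i).1)
        simp only [if_true, RCLike.conj_to_real]
        have := (hpos i).ne'
        field_simp
        rw [sq, h2]
      · have : (e i).1.1 ≠ (e j).1.1 := fun h => hij
          (e.injective (Subtype.val_injective (Subtype.val_injective h)))
        simp [this, hij]
    have h1 := hM _ h hh
    have h2 : ∀ i, ‖D (h i)‖ ^ 2 = μ (e i).1 := by
      intro i
      have h3 : D (h i) = Real.sqrt (μ (e i).1) • b (e i).1 := by
        have h4 : D (ContinuousLinearMap.adjoint D (b (e i).1)) = μ (e i).1 • b (e i).1 := hb _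
        simp only [h, map_smul, h4, smul_smul]
        congr 1
        have h2 := Real.mul_self_sqrt (hμ (e i).1)
        have := (hpos i).ne'
        field_simp
        rw [sq, h2]
      rw [h3, norm_smul, b.orthonormal.1, mul_one, Real.norm_eq_abs, sq_abs,
        Real.sq_sqrt (hμ _)]
    calc ∑ i ∈ F, μ i = ∑ i : F, μ i.1 := (Finset.sum_coe_sort F fun i => μ i.1).symm
      _ = ∑ i, μ (e i).1 := (e.sum_comp fun i : F => μ i.1).symm
      _ ≤ M := by simpa [h2] using h1
  · have h1 := (gramOp D).hasSum (b.hasSum_repr f)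
    have h2 : (fun i => gramOp D (b.repr f i • b i)) = fun i => (μ i * ⟪b i, f⟫_ℝ) • b i := by
      ext1 i
      rw [map_smul, hb, smul_smul, b.repr_apply_apply, mul_comm]
    rw [h2] at h1
    refine (hasSum_subtype_iff_of_support_subset (s := {i | 0 < μ i}) fun i hi => ?_).2 h1
    refine (hμ i).lt_of_ne fun h0 => hi ?_
    simp only [← h0, zero_mul, zero_smul]

/-- Let `P` be the projection onto the complement of `e`. Since `e` is an eigenvector, `(P D)(P D)*
= D D* - r e ⊗ e`, so the previous result applies to `P D`. This operator annihilates `e`, which is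
therefore orthogonal to eigenvectors with positive eigenvalues. -/
theorem exists_diagonalizes_gramOp_sub (D : G →L[ℝ] H) (hc : IsCompactOperator D) {M : ℝ}
    (hM : HilbertSchmidtBound D M) {e : H} (he : ‖e‖ = 1) {r : ℝ} (hr : gramOp D e = r • e) :
    ∃ (A : Type u) (φ : A → H) (μ : A → ℝ),
      Diagonalizes (gramOp D - r • (innerSL ℝ e).smulRight e) φ μ ∧ ∀ i, ⟪e, φ i⟫_ℝ = 0 := by
  let P : H →L[ℝ] H := ContinuousLinearMap.id ℝ H - (innerSL ℝ e).smulRight e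
  have hP : ∀ f, P f = f - ⟪e, f⟫_ℝ • e := fun f => by simp [P]
  have hee : ⟪e, e⟫_ℝ = 1 := by simp [he]
  have hPs : ∀ f g, ⟪P f, g⟫_ℝ = ⟪f, P g⟫_ℝ := fun f g => by
    simp only [hP, inner_sub_left, inner_sub_right, inner_smul_left, inner_smul_right,
      RCLike.conj_to_real, real_inner_comm e f]
    ring
  have hPa : ContinuousLinearMap.adjoint P = P :=
    ((ContinuousLinearMap.eq_adjoint_iff P P).2 hPs).symm
  have hPn : ∀ f, ‖P f‖ ^ 2 ≤ ‖f‖ ^ 2 := fun f => by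
    have h1 : ‖P f‖ ^ 2 = ‖f‖ ^ 2 - ⟪e, f⟫_ℝ ^ 2 := by
      rw [← real_inner_self_eq_norm_sq, ← real_inner_self_eq_norm_sq]
      simp only [hP, inner_sub_left, inner_sub_right, inner_smul_left, inner_smul_right,
        RCLike.conj_to_real, real_inner_comm e f, hee]
      ring
    rw [h1]
    linarith [sq_nonneg ⟪e, f⟫_ℝ]
  have hK : gramOp (P.comp D) = gramOp D - r • (innerSL ℝ e).smulRight e := by
    ext1 f
    have hef : ⟪e, gramOp D f⟫_ℝ = r * ⟪e, f⟫_ℝ := by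
      have := gramOp_isSymmetric D e f
      rw [ContinuousLinearMap.coe_coe, hr, inner_smul_left] at this
      simpa using this.symm
    have h1 : gramOp (P.comp D) f = P (gramOp D (P f)) := by
      simp only [gramOp, ContinuousLinearMap.adjoint_comp, hPa, ContinuousLinearMap.comp_apply]
    rw [h1, hP f, map_sub, map_smul, hr, hP]
    simp only [inner_sub_right, inner_smul_right, hef, hee, sub_apply,
      smul_apply, ContinuousLinearMap.smulRight_apply, innerSL_apply_apply]
    rw [smul_smul, smul_smul]
    have : r * ⟪e, f⟫_ℝ - ⟪e, f⟫_ℝ * (r * 1) = 0 := by ring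
    rw [this, zero_smul, sub_zero, mul_comm]
  obtain ⟨A, φ, μ, hd⟩ := exists_diagonalizes_gramOp (P.comp D) (hc.clm_comp P)
    (M := M) fun n h hh => (Finset.sum_le_sum fun i _ => hPn _).trans (hM n h hh)
  rw [hK] at hd
  refine ⟨A, φ, μ, hd, fun i => ?_⟩
  have h1 := congrArg (fun f => ⟪e, f⟫_ℝ) (hd.apply_eq i)
  have hef : ⟪e, gramOp D (φ i)⟫_ℝ = r * ⟪e, φ i⟫_ℝ := by
    have := gramOp_isSymmetric D e (φ i)
    rw [ContinuousLinearMap.coe_coe, hr, inner_smul_left] at this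
    simpa using this.symm
  simp only [sub_apply, smul_apply, inner_sub_right, hef,
    ContinuousLinearMap.smulRight_apply, innerSL_apply_apply, inner_smul_right, hee, mul_one,
    sub_self] at h1
  exact (mul_eq_zero.1 h1.symm).resolve_left (hd.pos i).ne'

end Gram

/-! ### Integral operators whose kernel is a Gram function -/

section Feature

universe v

open scoped InnerProductSpace

variable {T : Type*} [TopologicalSpace T] [CompactSpace T]
  {G : Type v} [NormedAddCommGroup G] [InnerProductSpace ℝ G]

/-- The operator that maps `h` to the continuous function `t ↦ ⟪x t, h⟫`. -/
noncomputable def evalOp (x : C(T, G)) : G →L[ℝ] BoundedContinuousFunction T ℝ :=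
  LinearMap.mkContinuous
    { toFun := fun h => BoundedContinuousFunction.mkOfCompact
        ⟨fun t => ⟪x t, h⟫_ℝ, by fun_prop⟩
      map_add' := fun h g => by ext t; simp [inner_add_right]
      map_smul' := fun c h => by ext t; simp [inner_smul_right] } ‖x‖ (by
    intro h
    refine (BoundedContinuousFunction.norm_le (by positivity)).2 fun t => ?_
    exact (norm_inner_le_norm _ _).trans (by gcongr; exact x.norm_coe_le_norm t))

theorem evalOp_apply (x : C(T, G)) (h : G) (t : T) : evalOp x h t = ⟪x t, h⟫_ℝ := rfl

/-- Arzelà-Ascoli: on the unit ball the images are bounded by `‖x‖`, and their increments by `‖x t -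
x s‖`, uniformly in `h`. -/
theorem isCompactOperator_evalOp (x : C(T, G)) : IsCompactOperator (evalOp x) := by
  refine (isCompactOperator_iff_isCompact_closure_image_closedBall
    (evalOp x : G →ₗ[ℝ] BoundedContinuousFunction T ℝ) one_pos).2 ?_
  refine BoundedContinuousFunction.arzela_ascoli (Metric.closedBall 0 ‖x‖)
    (isCompact_closedBall _ _) _ ?_ ?_
  · rintro _ t ⟨h, hh, rfl⟩
    rw [mem_closedBall_zero_iff] at hh ⊢
    refine (norm_inner_le_norm (x t) h).trans ?_
    calc ‖x t‖ * ‖h‖ ≤ ‖x‖ * 1 := by gcongr; exact x.norm_coe_le_norm t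
      _ = ‖x‖ := mul_one _
  · intro t
    rw [Metric.equicontinuousAt_iff_right]
    intro ε hε
    have := Metric.continuousAt_iff'.1 (x.continuous.continuousAt (x := t)) ε hε
    filter_upwards [this] with s hs
    rintro ⟨_, h, hh, rfl⟩
    rw [mem_closedBall_zero_iff] at hh
    have h1 : dist (evalOp x h t) (evalOp x h s) ≤ dist (x s) (x t) := by
      rw [dist_comm, dist_eq_norm, evalOp_apply, evalOp_apply, ← inner_sub_left, dist_eq_norm]
      exact (norm_inner_le_norm _ _).trans (mul_le_of_le_one_right (norm_nonneg _) hh)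
    exact h1.trans_lt hs

variable [MeasureSpace T] [BorelSpace T] [IsProbabilityMeasure (volume : Measure T)]

/-- The operator that maps `h` to the class of `t ↦ ⟪x t, h⟫` in `L₂(T)`. -/
noncomputable def featureOp (x : C(T, G)) : G →L[ℝ] Lp ℝ 2 (volume : Measure T) :=
  (BoundedContinuousFunction.toLp 2 volume ℝ).comp (evalOp x)

theorem coeFn_featureOp (x : C(T, G)) (h : G) :
    featureOp x h =ᵐ[volume] fun t => ⟪x t, h⟫_ℝ :=
  BoundedContinuousFunction.coeFn_toLp 2 volume ℝ (evalOp x h)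

theorem isCompactOperator_featureOp (x : C(T, G)) : IsCompactOperator (featureOp x) :=
  (isCompactOperator_evalOp x).clm_comp (BoundedContinuousFunction.toLp 2 volume ℝ)

theorem norm_featureOp_sq (x : C(T, G)) (h : G) :
    ‖featureOp x h‖ ^ 2 = ∫ t, ⟪x t, h⟫_ℝ ^ 2 := by
  rw [← real_inner_self_eq_norm_sq, L2.inner_def]
  refine integral_congr_ae ?_
  filter_upwards [coeFn_featureOp x h] with t ht
  rw [ht, real_inner_self_eq_norm_sq, Real.norm_eq_abs, sq_abs]

/-- Bessel's inequality for `x t` at each point `t`, integrated over a probability measure. -/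
theorem hilbertSchmidtBound_featureOp (x : C(T, G)) :
    HilbertSchmidtBound (featureOp x) (‖x‖ ^ 2) := by
  intro n h hh
  simp only [norm_featureOp_sq]
  have hcont : ∀ i, Continuous fun t => ⟪x t, h i⟫_ℝ ^ 2 := fun i => by fun_prop
  have hint : ∀ i, Integrable (fun t => ⟪x t, h i⟫_ℝ ^ 2) volume := fun i =>
    (BoundedContinuousFunction.mkOfCompact ⟨_, hcont i⟩).integrable volume
  rw [← integral_finsetSum _ fun i _ => hint i]
  calc ∫ t, ∑ i, ⟪x t, h i⟫_ℝ ^ 2 ≤ ∫ _t : T, ‖x‖ ^ 2 := by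
        refine integral_mono (integrable_finsetSum _ fun i _ => hint i) (integrable_const _)
          fun t => ?_
        have h1 := hh.sum_inner_products_le (x t) (s := Finset.univ)
        simp only [Real.norm_eq_abs, sq_abs, real_inner_comm (x t)] at h1
        exact h1.trans (by gcongr; exact x.norm_coe_le_norm t)
    _ = ‖x‖ ^ 2 := by simp

variable [CompleteSpace G]

theorem inner_adjoint_featureOp (x : C(T, G)) (f : Lp ℝ 2 (volume : Measure T)) (t : T) :
    ⟪x t, ContinuousLinearMap.adjoint (featureOp x) f⟫_ℝ = ∫ s, ⟪x t, x s⟫_ℝ * f s := by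
  rw [ContinuousLinearMap.adjoint_inner_right, L2.inner_def]
  refine integral_congr_ae ?_
  filter_upwards [coeFn_featureOp x (x t)] with s hs
  rw [hs, real_inner_comm (x t) (x s), RCLike.inner_apply, RCLike.conj_to_real, mul_comm]

theorem integralOp_eq_inner (x : C(T, G)) {C : T → T → ℝ} (hC : ∀ t s, C t s = ⟪x t, x s⟫_ℝ)
    (f : Lp ℝ 2 (volume : Measure T)) (t : T) :
    integralOp C f t = ⟪x t, ContinuousLinearMap.adjoint (featureOp x) f⟫_ℝ := by
  simp only [inner_adjoint_featureOp, integralOp, hC]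

/-- A Gram kernel factors the integral operator as `D D*` with `D = featureOp x`, which makes the
diagonalization of such operators available. -/
theorem coeFn_gramOp (x : C(T, G)) {C : T → T → ℝ} (hC : ∀ t s, C t s = ⟪x t, x s⟫_ℝ)
    (f : Lp ℝ 2 (volume : Measure T)) :
    gramOp (featureOp x) f =ᵐ[volume] integralOp C f := by
  filter_upwards [coeFn_featureOp x (ContinuousLinearMap.adjoint (featureOp x) f)] with t ht
  rw [integralOp_eq_inner x hC, ← ht]
  rfl

theorem eigenEq_iff (x : C(T, G)) {C : T → T → ℝ} (hC : ∀ t s, C t s = ⟪x t, x s⟫_ℝ)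
    (f : Lp ℝ 2 (volume : Measure T)) (w : ℝ) :
    EigenEq C w f ↔ gramOp (featureOp x) f = w • f := by
  have h1 := coeFn_gramOp x hC f
  have h2 := Lp.coeFn_smul w f
  constructor
  · intro h
    refine Lp.ext ?_
    filter_upwards [h, h1, h2] with t ht h1 h2
    rw [h1, ht, h2]
    rfl
  · intro h
    rw [h] at h1
    filter_upwards [h1, h2] with t h1 h2
    rw [← h1, h2]
    rfl

end Feature

/-! ### Covariance operators of the marginal processes. -/

section

open scoped InnerProductSpace

theorem covFun_eq_integral {T Ω : Type*} [MeasurableSpace Ω] {P : Measure Ω} {Z : T → Ω → ℝ}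
    (hZ : IsCentered P Z) (t s : T) : covFun P Z t s = ∫ ω, Z t ω * Z s ω ∂P := by
  simp [covFun, covariance, hZ.mean_zero]

/-- The values of a random function as elements of `L₂(P)`. -/
noncomputable def featureMap {T Ω : Type*} [MeasurableSpace Ω] {P : Measure Ω} {Z : T → Ω → ℝ}
    (hZ : IsCentered P Z) (t : T) : Lp ℝ 2 P := (hZ.memLp t).toLp (Z t)

theorem inner_featureMap {T Ω : Type*} [MeasurableSpace Ω] {P : Measure Ω} {Z : T → Ω → ℝ}
    (hZ : IsCentered P Z) (t s : T) : ⟪featureMap hZ t, featureMap hZ s⟫_ℝ = covFun P Z t s := by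
  rw [covFun_eq_integral hZ, L2.inner_def]
  refine integral_congr_ae ?_
  filter_upwards [(hZ.memLp t).coeFn_toLp, (hZ.memLp s).coeFn_toLp] with ω h1 h2
  rw [featureMap, featureMap, h1, h2, RCLike.inner_apply, RCLike.conj_to_real, mul_comm]

/-- Mean-square continuity: the squared increment is `C(s,s) - 2 C(s,t) + C(t,t)`. -/
theorem continuous_featureMap {T Ω : Type*} [TopologicalSpace T] [MeasurableSpace Ω]
    {P : Measure Ω} {Z : T → Ω → ℝ} (hZ : IsCentered P Z)
    (hc : Continuous (Function.uncurry (covFun P Z))) : Continuous (featureMap hZ) := by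
  rw [continuous_iff_continuousAt]
  intro t
  rw [ContinuousAt, tendsto_iff_norm_sub_tendsto_zero]
  have h1 : ∀ s, ‖featureMap hZ s - featureMap hZ t‖ =
      Real.sqrt (covFun P Z s s - 2 * covFun P Z s t + covFun P Z t t) := by
    intro s
    rw [← inner_featureMap hZ, ← inner_featureMap hZ, ← inner_featureMap hZ,
      real_inner_self_eq_norm_sq, real_inner_self_eq_norm_sq, ← norm_sub_sq_real,
      Real.sqrt_sq (norm_nonneg _)]
  simp only [h1]
  have hss : Continuous fun s => covFun P Z s s :=
    hc.comp (continuous_id.prodMk continuous_id)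
  have hst : Continuous fun s => covFun P Z s t :=
    hc.comp (continuous_id.prodMk continuous_const)
  have h2 : Continuous fun s =>
      Real.sqrt (covFun P Z s s - 2 * covFun P Z s t + covFun P Z t t) := by fun_prop
  have h3 := h2.tendsto t
  have h4 : covFun P Z t t - 2 * covFun P Z t t + covFun P Z t t = 0 := by ring
  simpa only [h4, Real.sqrt_zero] using h3

variable {T : Type*} [MeasureSpace T] [IsProbabilityMeasure (volume : Measure T)]

/-- The constant function `1` as an element of `L₂(T)`. -/
noncomputable def oneLp (T : Type*) [MeasureSpace T] [IsProbabilityMeasure (volume : Measure T)] :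
    Lp ℝ 2 (volume : Measure T) := Lp.const 2 volume (1 : ℝ)

theorem coeFn_oneLp : (oneLp T : T → ℝ) =ᵐ[volume] fun _ => 1 :=
  Lp.coeFn_const (p := 2) volume (1 : ℝ)

theorem inner_oneLp (f : Lp ℝ 2 (volume : Measure T)) : ⟪oneLp T, f⟫_ℝ = ∫ t, f t := by
  rw [L2.inner_def]
  refine integral_congr_ae ?_
  filter_upwards [coeFn_oneLp (T := T)] with t ht
  rw [ht, RCLike.inner_apply, RCLike.conj_to_real, mul_one]

theorem norm_oneLp : ‖oneLp T‖ = 1 := by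
  have h1 := inner_oneLp (oneLp T)
  rw [integral_congr_ae (coeFn_oneLp (T := T)), real_inner_self_eq_norm_sq] at h1
  have h2 : ‖oneLp T‖ ^ 2 = 1 := by rw [h1]; simp
  exact (pow_eq_one_iff_of_nonneg (norm_nonneg _) two_ne_zero).1 h2

/-- What is used of the spectral decomposition of a covariance operator that has the constant
function `1` among its eigenvectors, with eigenvalue `r`. -/
structure MarginalSpectrum (C : T → T → ℝ) (r : ℝ)
    (K : Lp ℝ 2 (volume : Measure T) →L[ℝ] Lp ℝ 2 (volume : Measure T))
    (φ : {k // 0 < remEigenvalue C k} → Lp ℝ 2 (volume : Measure T)) : Prop where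
  coeFn_apply : ∀ f, K f =ᵐ[volume] integralOp C f
  nonneg : 0 ≤ r
  rem_nonneg : ∀ k, 0 ≤ remEigenvalue C k
  rem_antitone : Antitone (remEigenvalue C)
  rem_summable : Summable (remEigenvalue C)
  trace_eq : trace C = r + remTrace C
  orthonormal : Orthonormal ℝ φ
  inner_one : ∀ k : {k // 0 < remEigenvalue C k}, ⟪oneLp T, φ k⟫_ℝ = 0
  hasSum : ∀ f, HasSum (fun k : {k // 0 < remEigenvalue C k} => remEigenvalue C k * ⟪φ k, f⟫_ℝ ^ 2)
    (⟪K f, f⟫_ℝ - r * ⟪oneLp T, f⟫_ℝ ^ 2)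

theorem exists_marginalSpectrum [TopologicalSpace T] [CompactSpace T] [BorelSpace T]
    {Ω : Type*} [MeasurableSpace Ω] {P : Measure Ω} {Z : T → Ω → ℝ} (hZ : IsCentered P Z)
    (hc : Continuous (Function.uncurry (covFun P Z))) {r : ℝ}
    (hr : EigenEq (covFun P Z) r fun _ => 1) :
    ∃ K φ, MarginalSpectrum (covFun P Z) r K φ := by
  set C := covFun P Z
  let x : C(T, Lp ℝ 2 P) := ⟨featureMap hZ, continuous_featureMap hZ hc⟩
  have hCx : ∀ t s, C t s = ⟪x t, x s⟫_ℝ := fun t s => (inner_featureMap hZ t s).symm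
  set K := gramOp (featureOp x) with hK
  have heig : ∀ (f : Lp ℝ 2 (volume : Measure T)) (w : ℝ), EigenEq C w f ↔ K f = w • f :=
    eigenEq_iff x hCx
  have hpsd : ∀ f, 0 ≤ ⟪K f, f⟫_ℝ := fun f => by
    rw [hK, inner_gramOp]; exact real_inner_self_nonneg
  have hev : ∀ f (w : ℝ), ‖f‖ = 1 → K f = w • f → 0 ≤ w := fun f w hf hw => by
    have := hpsd f
    rw [hw, inner_smul_left, real_inner_self_eq_norm_sq, hf] at this
    simpa using this
  have hr1 : K (oneLp T) = r • oneLp T := by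
    rw [← heig]
    have h1 : integralOp C (oneLp T) = integralOp C fun _ => 1 := by
      ext t
      refine integral_congr_ae ?_
      filter_upwards [coeFn_oneLp (T := T)] with s hs
      rw [hs]
    rw [EigenEq, h1]
    filter_upwards [hr, coeFn_oneLp (T := T)] with t h1 h2
    rw [h1, h2]
  have hr0 : 0 ≤ r := hev _ _ norm_oneLp hr1
  obtain ⟨A, φ, μ, hd, ho⟩ := exists_diagonalizes_gramOp_sub (featureOp x)
    (isCompactOperator_featureOp x) (hilbertSchmidtBound_featureOp x) norm_oneLp hr1
  rw [← hK] at hd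
  have hsub : ∀ f, (K - r • (innerSL ℝ (oneLp T)).smulRight (oneLp T)) f =
      K f - (r * ⟪oneLp T, f⟫_ℝ) • oneLp T := fun f => by
    simp [mul_smul]
  have hnn : ∀ {k : ℕ} {v : ℝ} (ψ : Fin (k + 1) → Lp ℝ 2 (volume : Measure T)),
      Orthonormal ℝ ψ → (∀ i, ∃ w, v ≤ w ∧ EigenEq C w (ψ i)) →
      ∀ i, ∃ w, 0 ≤ w ∧ EigenEq C w (ψ i) := fun ψ hψ hw i => by
    obtain ⟨w, _, h⟩ := hw i
    exact ⟨w, hev _ _ (hψ.1 i) ((heig _ _).1 h), h⟩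
  have hrem : Enumerates (fun k => {v : ℝ | ∃ φ : Fin (k + 1) → Lp ℝ 2 (volume : Measure T),
      Orthonormal ℝ φ ∧ ∀ i, ∫ t, φ i t = 0 ∧ ∃ w : ℝ, v ≤ w ∧ EigenEq C w (φ i)}) μ := by
    refine ⟨hd.pos, fun v hv => hd.finite hv, fun k v hv => ?_, fun k v => ?_⟩
    · rw [← hd.exists_orthonormal_iff hv]
      refine exists_congr fun ψ => and_congr_right fun hψ => forall_congr' fun i => ?_
      simp only [hsub, heig, ← inner_oneLp]
      constructor
      · rintro ⟨h0, w, hvw, hw⟩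
        exact ⟨w, hvw, by rw [h0, hw]; simp⟩
      · rintro ⟨w, hvw, hw⟩
        -- Pairing the eigenvalue equation of `K - r 1 ⊗ 1` with `1` gives `0 = w ⟪1, ψ i⟫`, and `w
        -- ≥ v > 0`.
        have h0 : ⟪oneLp T, ψ i⟫_ℝ = 0 := by
          have h1 := congrArg (fun f => ⟪oneLp T, f⟫_ℝ) hw
          have h2 := gramOp_isSymmetric (featureOp x) (oneLp T) (ψ i)
          rw [ContinuousLinearMap.coe_coe, ← hK, hr1, inner_smul_left] at h2
          simp only [inner_sub_right, inner_smul_right, ← h2, real_inner_self_eq_norm_sq,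
            norm_oneLp, RCLike.conj_to_real, one_pow, mul_one, sub_self] at h1
          exact (mul_eq_zero.1 h1.symm).resolve_left (hv.trans_le hvw).ne'
        refine ⟨h0, w, hvw, ?_⟩
        rw [h0] at hw
        simpa using hw
    · rintro ⟨ψ, hψ, hw⟩
      exact ⟨0, ⟨ψ, hψ, fun i => ⟨(hw i).1, hnn ψ hψ (fun i => (hw i).2) i⟩⟩, le_rfl⟩
  have heigS : ∀ {B : Type _} (χ : B → Lp ℝ 2 (volume : Measure T)) (ν : B → ℝ),
      Diagonalizes K χ ν → Enumerates (fun k => {v : ℝ | ∃ φ : Fin (k + 1) →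
        Lp ℝ 2 (volume : Measure T), Orthonormal ℝ φ ∧
          ∀ i, ∃ w : ℝ, v ≤ w ∧ EigenEq C w (φ i)}) ν := by
    intro B χ ν h
    refine ⟨h.pos, fun v hv => h.finite hv, fun k v hv => ?_, fun k v => ?_⟩
    · rw [← h.exists_orthonormal_iff hv]
      simp only [heig]
      rfl
    · rintro ⟨ψ, hψ, hw⟩
      exact ⟨0, ⟨ψ, hψ, hnn ψ hψ hw⟩, le_rfl⟩
  have hsum := (hrem.hasSum_iff id rfl (∑' i, μ i)).2 hd.summable.hasSum
  have htr : trace C = r + remTrace C := by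
    have h2 : remTrace C = ∑' i, μ i := hsum.tsum_eq
    rw [h2]
    refine HasSum.tsum_eq ?_
    -- If `r = 0`, the constant lies in the kernel and adds nothing to the positive spectrum; if `r
    -- > 0`, it is adjoined as one more eigenvector.
    rcases hr0.eq_or_lt with h0 | h0
    · rw [← h0, zero_smul, sub_zero] at hd
      rw [← h0, zero_add]
      exact ((heigS _ _ hd).hasSum_iff id rfl _).2 hd.summable.hasSum
    · refine ((heigS _ _ (hd.sum_unit h0 norm_oneLp ho)).hasSum_iff id rfl _).2 ?_
      rw [add_comm]
      exact HasSum.sum (f := Sum.elim μ fun _ : Unit => r) hd.summable.hasSum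
        (hasSum_unique fun _ : Unit => r)
  obtain ⟨e, he⟩ := hrem.exists_equiv
  have hd' := hd.reindex e
  refine ⟨K, φ ∘ e, coeFn_gramOp x hCx, hr0, hrem.sSup_nonneg, hrem.antitone, hsum.summable, htr,
    hd'.orthonormal, fun k => ho _, fun f => ?_⟩
  have h1 := hd'.hasSum_inner f
  rw [hsub, inner_sub_left, real_inner_smul_left] at h1
  have h2 : r * ⟪oneLp T, f⟫_ℝ ^ 2 = r * ⟪oneLp T, f⟫_ℝ * ⟪oneLp T, f⟫_ℝ := by ring
  have h3 : ∀ k : {k // 0 < remEigenvalue C k}, remEigenvalue C k = (μ ∘ e) k :=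
    fun k => (he k).symm
  simp only [h2, h3]
  exact h1

end

/-! ### Random fields as random elements of `L₂(T)` -/

section Hilbert

open scoped InnerProductSpace

theorem norm_sub_sum_sq {H : Type*} [NormedAddCommGroup H] [InnerProductSpace ℝ H] {n : ℕ}
    {e : Fin n → H} (he : Orthonormal ℝ e) (z : H) (c : Fin n → ℝ) :
    ‖z - ∑ i, c i • e i‖ ^ 2 = ‖z‖ ^ 2 - 2 * ∑ i, c i * ⟪e i, z⟫_ℝ + ∑ i, c i ^ 2 := by
  rw [norm_sub_sq_real, inner_sum, ← real_inner_self_eq_norm_sq (∑ i, c i • e i),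
    he.inner_sum c c Finset.univ]
  simp only [inner_smul_right, RCLike.conj_to_real, real_inner_comm z, sq]

/-- The span of `n` vectors has an orthonormal basis of at most `n` vectors, and the projection onto
it is the best approximation. -/
theorem exists_orthonormal_norm_sub_le {H : Type*} [NormedAddCommGroup H]
    [InnerProductSpace ℝ H] {n : ℕ} (ψ : Fin n → H) :
    ∃ r ≤ n, ∃ e : Fin r → H, Orthonormal ℝ e ∧ ∀ (z : H) (c : Fin n → ℝ),
      ‖z‖ ^ 2 - ∑ i, ⟪e i, z⟫_ℝ ^ 2 ≤ ‖z - ∑ i, c i • ψ i‖ ^ 2 := by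
  let V := Submodule.span ℝ (Set.range ψ)
  have : FiniteDimensional ℝ V := FiniteDimensional.span_of_finite ℝ (Set.finite_range ψ)
  let b := stdOrthonormalBasis ℝ V
  have hb : Orthonormal ℝ fun i => (b i : H) := b.orthonormal.comp_linearIsometry V.subtypeₗᵢ
  refine ⟨Module.finrank ℝ V, ?_, fun i => (b i : H), hb, fun z c => ?_⟩
  · have := finrank_range_le_card (R := ℝ) ψ
    simpa [Set.finrank] using this
  · have hv : ∑ i, c i • ψ i ∈ V :=
      Submodule.sum_mem _ fun i _ => Submodule.smul_mem _ _ (Submodule.subset_span ⟨i, rfl⟩)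
    have h1 : ∑ i, c i • ψ i = ∑ i, (b.repr ⟨_, hv⟩) i • (b i : H) := by
      have := congrArg (Subtype.val : V → H) (b.sum_repr ⟨_, hv⟩)
      refine Eq.trans (show _ = _ from this.symm) ?_
      simp
    rw [h1, norm_sub_sum_sq hb, sub_add, sub_le_sub_iff_left, Finset.mul_sum,
      ← Finset.sum_sub_distrib]
    refine Finset.sum_le_sum fun i _ => ?_
    nlinarith [sq_nonneg ((b.repr ⟨_, hv⟩) i - ⟪(b i : H), z⟫_ℝ)]

/-- Orthonormal vectors are `√2` apart, so the balls of radius `1/2` around them are disjoint.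
Countability permits summing under the expectation in Parseval's identity. -/
theorem Orthonormal.countable {H : Type*} [NormedAddCommGroup H] [InnerProductSpace ℝ H]
    [TopologicalSpace.SeparableSpace H] {A : Type*} {φ : A → H} (h : Orthonormal ℝ φ) :
    Countable A := by
  have hd : ∀ i j, i ≠ j → 1 < dist (φ i) (φ j) := by
    intro i j hij
    have h1 : dist (φ i) (φ j) ^ 2 = 2 := by
      rw [dist_eq_norm, norm_sub_sq_real, h.1, h.1, h.2 hij]
      norm_num
    nlinarith [dist_nonneg (x := φ i) (y := φ j)]
  have := Set.PairwiseDisjoint.countable_of_isOpen (s := fun i => Metric.ball (φ i) (1 / 2))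
    (a := Set.univ) (fun i _ j _ hij => Metric.ball_disjoint_ball (by
      have := hd i j hij; linarith)) (fun i _ => Metric.isOpen_ball)
      (fun i _ => ⟨φ i, Metric.mem_ball_self (by norm_num)⟩)
  exact Set.countable_univ_iff.1 this

end Hilbert

/-! ### Second moments of sample paths and errors of rank `n`. -/

section Field

open scoped InnerProductSpace

variable {T Ω : Type*} [MeasureSpace T] [MeasurableSpace Ω] {P : Measure Ω} {Z : T → Ω → ℝ}

/-- A jointly measurable centered random field with integrable variance. -/
structure IsField (P : Measure Ω) (Z : T → Ω → ℝ) : Prop where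
  centered : IsCentered P Z
  measurable : Measurable (Function.uncurry Z)
  integrable : Integrable fun t => covFun P Z t t

/-- A sample path as an element of `L₂(T)`. -/
noncomputable def path (Z : T → Ω → ℝ) (ω : Ω) : Lp ℝ 2 (volume : Measure T) :=
  open Classical in
  if h : MemLp (fun t => Z t ω) 2 volume then h.toLp (fun t => Z t ω) else 0

namespace IsField

variable [IsProbabilityMeasure P]

theorem integrable_sq (hZ : IsField P Z) :
    Integrable (fun p : T × Ω => Z p.1 p.2 ^ 2) ((volume : Measure T).prod P) := by
  have hm : Measurable fun p : T × Ω => Z p.1 p.2 ^ 2 := hZ.measurable.pow_const 2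
  rw [integrable_prod_iff hm.aestronglyMeasurable]
  refine ⟨Eventually.of_forall fun t => (hZ.centered.memLp t).integrable_sq, ?_⟩
  refine hZ.integrable.congr (Eventually.of_forall fun t => ?_)
  simp only [covFun_eq_integral hZ.centered, Real.norm_eq_abs, abs_sq]
  exact integral_congr_ae (Eventually.of_forall fun ω => by simp [sq])

theorem memLp_uncurry (hZ : IsField P Z) :
    MemLp (fun p : T × Ω => Z p.1 p.2) 2 ((volume : Measure T).prod P) :=
  (memLp_two_iff_integrable_sq hZ.measurable.aestronglyMeasurable).2 hZ.integrable_sq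

variable [IsProbabilityMeasure (volume : Measure T)]

/-- By Fubini, the default value `0` in `path` is used only on a null set. -/
theorem ae_memLp (hZ : IsField P Z) : ∀ᵐ ω ∂P, MemLp (fun t => Z t ω) 2 volume := by
  filter_upwards [hZ.integrable_sq.prod_left_ae] with ω hω
  exact (memLp_two_iff_integrable_sq
    (hZ.measurable.comp measurable_prodMk_right).aestronglyMeasurable).2 hω

theorem coeFn_path (hZ : IsField P Z) : ∀ᵐ ω ∂P, path Z ω =ᵐ[volume] fun t => Z t ω := by
  filter_upwards [hZ.ae_memLp] with ω hω
  rw [path, dif_pos hω]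
  exact hω.coeFn_toLp

theorem inner_path (hZ : IsField P Z) (f : Lp ℝ 2 (volume : Measure T)) :
    ∀ᵐ ω ∂P, ⟪f, path Z ω⟫_ℝ = ∫ t, Z t ω * f t := by
  filter_upwards [hZ.coeFn_path] with ω hω
  rw [L2.inner_def]
  refine integral_congr_ae ?_
  filter_upwards [hω] with t ht
  rw [ht, RCLike.inner_apply, RCLike.conj_to_real]

theorem norm_path_sq (hZ : IsField P Z) : ∀ᵐ ω ∂P, ‖path Z ω‖ ^ 2 = ∫ t, Z t ω ^ 2 := by
  filter_upwards [hZ.coeFn_path] with ω hω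
  rw [← real_inner_self_eq_norm_sq, L2.inner_def]
  refine integral_congr_ae ?_
  filter_upwards [hω] with t ht
  rw [ht, RCLike.inner_apply, RCLike.conj_to_real, sq]

theorem integrable_norm_path_sq (hZ : IsField P Z) : Integrable (fun ω => ‖path Z ω‖ ^ 2) P :=
  hZ.integrable_sq.integral_prod_right.congr (by
    filter_upwards [hZ.norm_path_sq] with ω hω using hω.symm)

theorem integral_norm_path_sq (hZ : IsField P Z) :
    ∫ ω, ‖path Z ω‖ ^ 2 ∂P = ∫ t, covFun P Z t t := by
  rw [integral_congr_ae hZ.norm_path_sq]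
  simp only [covFun_eq_integral hZ.centered, ← sq]
  exact integral_integral_swap (f := fun ω t => Z t ω ^ 2) hZ.integrable_sq.swap

theorem integrable_mul (hZ : IsField P Z) (f : Lp ℝ 2 (volume : Measure T)) {h : Ω → ℝ}
    (hh : MemLp h 2 P) :
    Integrable (fun p : T × Ω => Z p.1 p.2 * (f p.1 * h p.2)) ((volume : Measure T).prod P) := by
  have h2 : MemLp (fun p : T × Ω => f p.1 * h p.2) 2 ((volume : Measure T).prod P) := ?_
  · exact hZ.memLp_uncurry.integrable_mul h2
  rw [memLp_two_iff_integrable_sq]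
  · have := (Lp.memLp f).integrable_sq.mul_prod hh.integrable_sq
    refine this.congr (Eventually.of_forall fun p => ?_)
    simp only [mul_pow]
  · exact ((Lp.memLp f).aestronglyMeasurable.comp_fst).mul (hh.aestronglyMeasurable.comp_snd)

/-- Measurability comes from the parametric integral of the jointly measurable field, so
measurability of `path` as a map into `L₂` is not needed. The bound is Cauchy-Schwarz. -/
theorem memLp_inner (hZ : IsField P Z) (f : Lp ℝ 2 (volume : Measure T)) :
    MemLp (fun ω => ⟪f, path Z ω⟫_ℝ) 2 P := by
  have hm : AEStronglyMeasurable (fun ω => ⟪f, path Z ω⟫_ℝ) P := by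
    have h1 := (hZ.integrable_mul f (memLp_const 1)).swap.aestronglyMeasurable.integral_prod_right'
    refine h1.congr ?_
    filter_upwards [hZ.inner_path f] with ω hω
    rw [hω]
    simp
  rw [memLp_two_iff_integrable_sq hm]
  refine (hZ.integrable_norm_path_sq.const_mul (‖f‖ ^ 2)).mono' (hm.pow 2)
    (Eventually.of_forall fun ω => ?_)
  rw [Real.norm_eq_abs, abs_sq, ← sq_abs, ← mul_pow]
  gcongr
  exact abs_real_inner_le_norm f (path Z ω)

theorem integral_inner_mul (hZ : IsField P Z) (f : Lp ℝ 2 (volume : Measure T)) {h : Ω → ℝ}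
    (hh : MemLp h 2 P) :
    ∫ ω, ⟪f, path Z ω⟫_ℝ * h ω ∂P = ∫ t, f t * ∫ ω, Z t ω * h ω ∂P := by
  have h1 : ∫ ω, ⟪f, path Z ω⟫_ℝ * h ω ∂P = ∫ ω, ∫ t : T, Z t ω * (f t * h ω) ∂volume ∂P := by
    refine integral_congr_ae ?_
    filter_upwards [hZ.inner_path f] with ω hω
    rw [hω, ← integral_mul_const]
    simp only [mul_assoc]
  rw [h1, integral_integral_swap (f := fun ω t => Z t ω * (f t * h ω))
    (hZ.integrable_mul f hh).swap]
  refine integral_congr_ae (Eventually.of_forall fun t => ?_)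
  simp only
  rw [← integral_const_mul]
  exact integral_congr_ae (Eventually.of_forall fun ω => by simp only; ring)

/-- The quadratic form of the covariance operator of a field. -/
theorem integral_inner_sq (hZ : IsField P Z) (f : Lp ℝ 2 (volume : Measure T)) :
    ∫ ω, ⟪f, path Z ω⟫_ℝ ^ 2 ∂P = ∫ t, f t * integralOp (covFun P Z) f t := by
  simp only [sq]
  -- Fubini is applied twice: here with `h` the inner product itself, below with `h = Z t`.
  rw [hZ.integral_inner_mul f (hZ.memLp_inner f)]
  refine integral_congr_ae (Eventually.of_forall fun t => ?_)
  simp only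
  congr 1
  simp only [mul_comm (Z t _)]
  rw [hZ.integral_inner_mul f (hZ.centered.memLp t), integralOp]
  refine integral_congr_ae (Eventually.of_forall fun s => ?_)
  simp only
  rw [covFun_eq_integral hZ.centered, mul_comm]
  simp only [mul_comm (Z s _)]

theorem lintegral_approx (hZ : IsField P Z) {n : ℕ}
    (ψ : Fin n → Lp ℝ 2 (volume : Measure T)) :
    ∫⁻ ω, ∫⁻ t, ‖Z t ω - rankApprox ψ (fun s => Z s ω) t‖ₑ ^ 2 ∂volume ∂P =
      ∫⁻ ω, ENNReal.ofReal (‖path Z ω - ∑ m, ⟪ψ m, path Z ω⟫_ℝ • ψ m‖ ^ 2) ∂P := by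
  refine lintegral_congr_ae ?_
  have h1 : ∀ᵐ ω ∂P, ∀ m, ⟪ψ m, path Z ω⟫_ℝ = ∫ t, Z t ω * ψ m t :=
    ae_all_iff.2 fun m => hZ.inner_path (ψ m)
  filter_upwards [h1, hZ.coeFn_path] with ω h1 h2
  set g := path Z ω - ∑ m, ⟪ψ m, path Z ω⟫_ℝ • ψ m with hg
  have h3 : g =ᵐ[volume] fun t => Z t ω - rankApprox ψ (fun s => Z s ω) t := by
    have h4 : ∀ᵐ t, ∀ m, (⟪ψ m, path Z ω⟫_ℝ • ψ m : Lp ℝ 2 (volume : Measure T)) t =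
        ⟪ψ m, path Z ω⟫_ℝ * ψ m t := ae_all_iff.2 fun m => Lp.coeFn_smul _ _
    filter_upwards [Lp.coeFn_sub (path Z ω) (∑ m, ⟪ψ m, path Z ω⟫_ℝ • ψ m), h2, h4,
      Lp.coeFn_finsetSum Finset.univ fun m => ⟪ψ m, path Z ω⟫_ℝ • ψ m] with t h5 h6 h7 h8
    rw [hg, h5, Pi.sub_apply, h6, h8, rankApprox]
    simp only [Finset.sum_apply, h7]
    simp only [h1]
  have h4 : ‖g‖ ^ 2 = ∫ t, ‖g t‖ ^ 2 := by
    rw [← real_inner_self_eq_norm_sq, L2.inner_def]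
    simp only [real_inner_self_eq_norm_sq]
  rw [h4, ofReal_integral_eq_lintegral_ofReal ((memLp_two_iff_integrable_sq_norm
    (Lp.memLp g).aestronglyMeasurable).1 (Lp.memLp g))
    (Eventually.of_forall fun t => by positivity)]
  refine lintegral_congr_ae ?_
  filter_upwards [h3] with t ht
  rw [ht, ENNReal.ofReal_pow (norm_nonneg _), ofReal_norm]

theorem lintegral_approx_orthonormal (hZ : IsField P Z) {n : ℕ}
    {ψ : Fin n → Lp ℝ 2 (volume : Measure T)} (hψ : Orthonormal ℝ ψ) :
    ∫⁻ ω, ∫⁻ t, ‖Z t ω - rankApprox ψ (fun s => Z s ω) t‖ₑ ^ 2 ∂volume ∂P =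
      ENNReal.ofReal ((∫ t, covFun P Z t t) - ∑ m, ∫ ω, ⟪ψ m, path Z ω⟫_ℝ ^ 2 ∂P) := by
  have h1 : ∀ ω, ‖path Z ω - ∑ m, ⟪ψ m, path Z ω⟫_ℝ • ψ m‖ ^ 2 =
      ‖path Z ω‖ ^ 2 - ∑ m, ⟪ψ m, path Z ω⟫_ℝ ^ 2 := fun ω => by
    rw [norm_sub_sum_sq hψ]
    simp only [← sq]
    ring
  have hint : ∀ m, Integrable (fun ω => ⟪ψ m, path Z ω⟫_ℝ ^ 2) P :=
    fun m => (hZ.memLp_inner (ψ m)).integrable_sq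
  have h2 : Integrable (fun ω => ‖path Z ω‖ ^ 2 - ∑ m, ⟪ψ m, path Z ω⟫_ℝ ^ 2) P :=
    hZ.integrable_norm_path_sq.sub (integrable_finsetSum Finset.univ fun m _ => hint m)
  rw [hZ.lintegral_approx, ← hZ.integral_norm_path_sq,
    ← integral_finsetSum _ fun m _ => hint m,
    ← integral_sub hZ.integrable_norm_path_sq (integrable_finsetSum Finset.univ fun m _ => hint m),
    ofReal_integral_eq_lintegral_ofReal h2
      (Eventually.of_forall fun ω => by
        simp only [Pi.zero_apply, ← h1]
        positivity)]
  simp only [h1]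

/-- The output of the algorithm lies in the span of `ψ`, where the orthogonal projection is the best
choice path by path. So lower bounds need only orthonormal families. -/
theorem exists_orthonormal_le_lintegral_approx (hZ : IsField P Z) {n : ℕ}
    (ψ : Fin n → Lp ℝ 2 (volume : Measure T)) :
    ∃ r ≤ n, ∃ e : Fin r → Lp ℝ 2 (volume : Measure T), Orthonormal ℝ e ∧
      ENNReal.ofReal ((∫ t, covFun P Z t t) - ∑ m, ∫ ω, ⟪e m, path Z ω⟫_ℝ ^ 2 ∂P) ≤
        ∫⁻ ω, ∫⁻ t, ‖Z t ω - rankApprox ψ (fun s => Z s ω) t‖ₑ ^ 2 ∂volume ∂P := by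
  obtain ⟨r, hr, e, he, hle⟩ := exists_orthonormal_norm_sub_le ψ
  refine ⟨r, hr, e, he, ?_⟩
  rw [← hZ.lintegral_approx_orthonormal he, hZ.lintegral_approx, hZ.lintegral_approx]
  refine lintegral_mono fun ω => ENNReal.ofReal_le_ofReal ?_
  refine le_trans (le_of_eq ?_) (hle (path Z ω) fun m => ⟪ψ m, path Z ω⟫_ℝ)
  rw [norm_sub_sum_sq he]
  simp only [← sq]
  ring

/-- Parseval's identity for the variance of a field. -/
theorem hasSum_hilbertBasis (hZ : IsField P Z)
    [TopologicalSpace.SeparableSpace (Lp ℝ 2 (volume : Measure T))] {ι : Type*}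
    (b : HilbertBasis ι ℝ (Lp ℝ 2 (volume : Measure T))) :
    HasSum (fun i => ∫ ω, ⟪b i, path Z ω⟫_ℝ ^ 2 ∂P) (∫ t, covFun P Z t t) := by
  have := Orthonormal.countable b.orthonormal
  have hint : ∀ i, Integrable (fun ω => ⟪b i, path Z ω⟫_ℝ ^ 2) P :=
    fun i => (hZ.memLp_inner (b i)).integrable_sq
  have hpars : ∀ z, HasSum (fun i => ⟪b i, z⟫_ℝ ^ 2) (‖z‖ ^ 2) := fun z => by
    have h1 := b.hasSum_inner_mul_inner z z
    simpa only [real_inner_self_eq_norm_sq, real_inner_comm z, sq] using h1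
  rw [← hZ.integral_norm_path_sq]
  refine hasSum_integral_of_dominated_convergence (fun i ω => ⟪b i, path Z ω⟫_ℝ ^ 2)
    (fun i => (hint i).aestronglyMeasurable) (fun i => Eventually.of_forall fun ω => ?_)
    (Eventually.of_forall fun ω => (hpars (path Z ω)).summable) ?_
    (Eventually.of_forall fun ω => hpars (path Z ω))
  · rw [Real.norm_eq_abs, abs_sq]
  · simp only [(hpars _).tsum_eq]
    exact hZ.integrable_norm_path_sq

end IsField

/-- `Φ` is an orthonormal family of eigenvectors of the covariance operator of the field `Z`, with
eigenvalues `w`, that diagonalizes this operator. -/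
structure FieldSpectrum {A : Type*} (P : Measure Ω) (Z : T → Ω → ℝ)
    (Φ : A → Lp ℝ 2 (volume : Measure T)) (w : A → ℝ) : Prop where
  isField : IsField P Z
  orthonormal : Orthonormal ℝ Φ
  nonneg : ∀ i, 0 ≤ w i
  hasSum : ∀ f, HasSum (fun i => w i * ⟪Φ i, f⟫_ℝ ^ 2) (∫ ω, ⟪f, path Z ω⟫_ℝ ^ 2 ∂P)

theorem ofReal_rpow_half (a : ℝ) :
    ENNReal.ofReal a ^ (1 / 2 : ℝ) = ENNReal.ofReal (Real.sqrt a) := by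
  rcases le_total 0 a with h | h
  · rw [ENNReal.ofReal_rpow_of_nonneg h (by norm_num), Real.sqrt_eq_rpow]
  · rw [ENNReal.ofReal_of_nonpos h, Real.sqrt_eq_zero_of_nonpos h]
    simp

namespace FieldSpectrum

variable {A : Type*} {Φ : A → Lp ℝ 2 (volume : Measure T)} {w : A → ℝ}

theorem integral_inner_sq (h : FieldSpectrum P Z Φ w) (i : A) :
    ∫ ω, ⟪Φ i, path Z ω⟫_ℝ ^ 2 ∂P = w i := by
  classical
  refine (h.hasSum (Φ i)).unique ?_
  convert hasSum_ite_eq i (w i) using 2 with j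
  rw [orthonormal_iff_ite.1 h.orthonormal j i]
  split_ifs with hij
  · rw [hij]; simp
  · simp

/-- The captured variance is `∑ w i * c i` with `c i = ∑ₘ ⟪Φ i, e m⟫²`. Bessel's inequality in both
directions gives `0 ≤ c i ≤ 1` and `∑ c i ≤ r`; use the first on `F` and the second off `F`. -/
theorem sum_integral_inner_sq_le (h : FieldSpectrum P Z Φ w) {F : Finset A} {θ : ℝ} (hθ : 0 ≤ θ)
    (hF : ∀ i ∉ F, w i ≤ θ) {r : ℕ} {e : Fin r → Lp ℝ 2 (volume : Measure T)}
    (he : Orthonormal ℝ e) :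
    ∑ m, ∫ ω, ⟪e m, path Z ω⟫_ℝ ^ 2 ∂P ≤ ∑ i ∈ F, w i + r * θ := by
  classical
  have h1 : HasSum (fun i => ∑ m, w i * ⟪Φ i, e m⟫_ℝ ^ 2)
      (∑ m, ∫ ω, ⟪e m, path Z ω⟫_ℝ ^ 2 ∂P) := hasSum_sum fun m _ => h.hasSum (e m)
  have h2 : ∀ m, Summable fun i => ⟪Φ i, e m⟫_ℝ ^ 2 := fun m => by
    have := h.orthonormal.inner_products_summable (e m)
    simpa only [Real.norm_eq_abs, sq_abs] using this
  have h3 : HasSum (fun i => ∑ m, ⟪Φ i, e m⟫_ℝ ^ 2) (∑ m, ∑' i, ⟪Φ i, e m⟫_ℝ ^ 2) :=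
    hasSum_sum fun m _ => (h2 m).hasSum
  have h4 : ∑ m, ∑' i, ⟪Φ i, e m⟫_ℝ ^ 2 ≤ r := by
    calc ∑ m, ∑' i, ⟪Φ i, e m⟫_ℝ ^ 2 ≤ ∑ m : Fin r, (1 : ℝ) := by
          refine Finset.sum_le_sum fun m _ => ?_
          have := h.orthonormal.tsum_inner_products_le (e m)
          simpa only [Real.norm_eq_abs, sq_abs, he.1, one_pow] using this
      _ = r := by simp
  have h5 : HasSum (fun i => (if i ∈ F then w i else 0) + θ * ∑ m, ⟪Φ i, e m⟫_ℝ ^ 2)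
      (∑ i ∈ F, w i + θ * ∑ m, ∑' i, ⟪Φ i, e m⟫_ℝ ^ 2) := by
    refine HasSum.add ?_ (h3.mul_left θ)
    have : HasSum (fun i => if i ∈ F then w i else 0) (∑ i ∈ F, if i ∈ F then w i else 0) :=
      hasSum_sum_of_ne_finset_zero fun i hi => if_neg hi
    rwa [Finset.sum_congr rfl fun i hi => if_pos hi] at this
  have h6 := hasSum_le (fun i => ?_) h1 h5
  · refine h6.trans ?_
    rw [mul_comm θ]
    gcongr
  · rw [← Finset.mul_sum]
    have h7 : 0 ≤ ∑ m, ⟪Φ i, e m⟫_ℝ ^ 2 := Finset.sum_nonneg fun m _ => sq_nonneg _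
    have h8 : ∑ m, ⟪Φ i, e m⟫_ℝ ^ 2 ≤ 1 := by
      have := he.sum_inner_products_le (Φ i) (s := Finset.univ)
      simpa only [Real.norm_eq_abs, sq_abs, h.orthonormal.1, one_pow,
        real_inner_comm (Φ i)] using this
    split_ifs with hi
    · exact (mul_le_of_le_one_right (h.nonneg i) h8).trans (le_add_of_nonneg_right (by positivity))
    · rw [zero_add]
      exact mul_le_mul_of_nonneg_right (hF i hi) h7

variable [IsProbabilityMeasure (volume : Measure T)] [IsProbabilityMeasure P]

/-- Extend `Φ` to a Hilbert basis and apply Parseval; the quadratic form vanishes on the added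
vectors. -/
theorem hasSum_trace (h : FieldSpectrum P Z Φ w)
    [TopologicalSpace.SeparableSpace (Lp ℝ 2 (volume : Measure T))] :
    HasSum w (∫ t, covFun P Z t t) := by
  obtain ⟨W, b, hW, hb⟩ := h.orthonormal.toSubtypeRange.exists_hilbertBasis_extension
  have h1 := h.isField.hasSum_hilbertBasis b
  let g : A → W := fun i => ⟨Φ i, hW ⟨i, rfl⟩⟩
  have hg : Function.Injective g := fun i j hij =>
    h.orthonormal.linearIndependent.injective (congrArg Subtype.val hij)
  have h2 := (hg.hasSum_iff (f := fun i => ∫ ω, ⟪b i, path Z ω⟫_ℝ ^ 2 ∂P)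
    (a := ∫ t, covFun P Z t t) ?_).2 h1
  · refine h2.congr_fun fun i => ?_
    have h4 : b (g i) = Φ i := by rw [hb]
    rw [Function.comp_apply, h4]
    exact (h.integral_inner_sq i).symm
  · intro y hy
    refine (h.hasSum (b y)).unique ?_
    have h3 : ∀ i, ⟪Φ i, b y⟫_ℝ = 0 := fun i => by
      have h4 : Φ i = b (g i) := by rw [hb]
      rw [h4]
      exact b.orthonormal.2 fun hiy => hy ⟨i, hiy⟩
    simp only [h3]
    simp

theorem approxError_zero (h : FieldSpectrum P Z Φ w) :
    approxError P Z 0 = ENNReal.ofReal (Real.sqrt (∫ t, covFun P Z t t)) := by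
  have he : ∀ ψ : Fin 0 → Lp ℝ 2 (volume : Measure T), Orthonormal ℝ ψ := fun ψ =>
    ⟨fun i => i.elim0, fun i => i.elim0⟩
  simp only [approxError, h.isField.lintegral_approx_orthonormal (he _), Finset.univ_eq_empty,
    Finset.sum_empty, sub_zero, ofReal_rpow_half, ciInf_const]

theorem approxError_card_le (h : FieldSpectrum P Z Φ w) (F : Finset A) :
    approxError P Z F.card ≤
      ENNReal.ofReal (Real.sqrt ((∫ t, covFun P Z t t) - ∑ i ∈ F, w i)) := by
  let e := F.equivFin.symm
  have ho : Orthonormal ℝ fun i => Φ (e i) :=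
    h.orthonormal.comp _ (Subtype.val_injective.comp e.injective)
  refine (iInf_le _ fun i => Φ (e i)).trans (le_of_eq ?_)
  rw [h.isField.lintegral_approx_orthonormal ho, ofReal_rpow_half]
  simp only [h.integral_inner_sq]
  rw [e.sum_comp fun i : F => w i, Finset.sum_coe_sort F w]

theorem le_approxError (h : FieldSpectrum P Z Φ w) {F : Finset A} {θ : ℝ} (hθ : 0 ≤ θ)
    (hF : ∀ i ∉ F, w i ≤ θ) (n : ℕ) :
    ENNReal.ofReal (Real.sqrt ((∫ t, covFun P Z t t) - (∑ i ∈ F, w i + n * θ))) ≤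
      approxError P Z n := by
  refine le_iInf fun ψ => ?_
  obtain ⟨r, hr, e, he, hle⟩ := h.isField.exists_orthonormal_le_lintegral_approx ψ
  rw [← ofReal_rpow_half]
  refine ENNReal.rpow_le_rpow (le_trans (ENNReal.ofReal_le_ofReal ?_) hle) (by norm_num)
  have h1 := h.sum_integral_inner_sq_le hθ hF he
  have h2 : (r : ℝ) * θ ≤ n * θ := by gcongr
  linarith

/-- The upper bound of the complexity by the number of large eigenvalues. -/
theorem approxComplexity_le_card (h : FieldSpectrum P Z Φ w) {F : Finset A} (hF : F.Nonempty)
    {ε : ℝ} (hε : 0 < ε)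
    (hle : (∫ t, covFun P Z t t) - ∑ i ∈ F, w i ≤ ε ^ 2 * ∫ t, covFun P Z t t) :
    approxComplexity P Z ε ≤ F.card ∧ 1 ≤ approxComplexity P Z ε ∧
      approxError P Z (approxComplexity P Z ε) ≤ ENNReal.ofReal ε * approxError P Z 0 := by
  have hmem : F.card ∈ {n : ℕ | 1 ≤ n ∧ approxError P Z n ≤
      ENNReal.ofReal ε * approxError P Z 0} := by
    refine ⟨hF.card_pos, (h.approxError_card_le F).trans ?_⟩
    rw [h.approxError_zero, ← ENNReal.ofReal_mul hε.le]
    refine ENNReal.ofReal_le_ofReal ((Real.sqrt_le_sqrt hle).trans (le_of_eq ?_))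
    rw [Real.sqrt_mul (sq_nonneg _), Real.sqrt_sq hε.le]
  -- Nonemptiness makes the complexity a true minimum rather than the default value `0` of `sInf ∅`.
  have h1 := Nat.sInf_mem ⟨_, hmem⟩
  exact ⟨Nat.sInf_le hmem, h1.1, h1.2⟩

/-- The lower bound of the complexity by the sum of the large eigenvalues. -/
theorem le_of_approxError_le (h : FieldSpectrum P Z Φ w) {F : Finset A} {θ : ℝ} (hθ : 0 ≤ θ)
    (hF : ∀ i ∉ F, w i ≤ θ) {ε : ℝ} (hε : 0 < ε) (hτ : 0 ≤ ∫ t, covFun P Z t t) {n : ℕ}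
    (hn : approxError P Z n ≤ ENNReal.ofReal ε * approxError P Z 0) :
    (∫ t, covFun P Z t t) - (∑ i ∈ F, w i + n * θ) ≤ ε ^ 2 * ∫ t, covFun P Z t t := by
  have h1 := (h.le_approxError hθ hF n).trans hn
  rw [h.approxError_zero, ← ENNReal.ofReal_mul hε.le,
    ENNReal.ofReal_le_ofReal_iff (by positivity), Real.sqrt_le_left (by positivity), mul_pow,
    Real.sq_sqrt hτ] at h1
  exact h1

end FieldSpectrum

end Field

/-! ### The spectrum of an additive random field -/

section Lift

open scoped InnerProductSpace

variable {T : Type*} [MeasureSpace T] [IsProbabilityMeasure (volume : Measure T)] {d : ℕ}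

/-- A function of one variable as a function of `d` variables that depends on the `j`-th one. -/
noncomputable def coordLift (j : Fin d) :
    Lp ℝ 2 (volume : Measure T) →ₗᵢ[ℝ] Lp ℝ 2 (volume : Measure (Fin d → T)) :=
  Lp.compMeasurePreservingₗᵢ ℝ (Function.eval j)
    (measurePreserving_eval (fun _ : Fin d => (volume : Measure T)) j)

theorem coeFn_coordLift (j : Fin d) (f : Lp ℝ 2 (volume : Measure T)) :
    coordLift j f =ᵐ[volume] fun t => f (t j) :=
  Lp.coeFn_compMeasurePreserving f
    (measurePreserving_eval (fun _ : Fin d => (volume : Measure T)) j)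

theorem ae_coord (j : Fin d) {p : T → Prop} (h : ∀ᵐ u, p u) : ∀ᵐ t : Fin d → T, p (t j) :=
  (measurePreserving_eval (fun _ : Fin d => (volume : Measure T)) j).quasiMeasurePreserving.ae h

theorem coordLift_oneLp (j : Fin d) : coordLift j (oneLp T) = oneLp (Fin d → T) := by
  refine Lp.ext ?_
  filter_upwards [coeFn_coordLift j (oneLp T), coeFn_oneLp (T := Fin d → T),
    ae_coord j (coeFn_oneLp (T := T))] with t h1 h2 h3
  rw [h1, h2, h3]

/-- Different coordinates are independent under the product measure. In particular, lifts of
functions orthogonal to `1` are mutually orthogonal. -/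
theorem inner_coordLift_of_ne {i j : Fin d} (hij : i ≠ j) (f g : Lp ℝ 2 (volume : Measure T)) :
    ⟪coordLift i f, coordLift j g⟫_ℝ = ⟪oneLp T, f⟫_ℝ * ⟪oneLp T, g⟫_ℝ := by
  let F : Fin d → T → ℝ := fun k u => if k = i then f u else if k = j then g u else 1
  have h1 : ∀ t : Fin d → T, ∏ k, F k (t k) = f (t i) * g (t j) := by
    intro t
    rw [Finset.prod_eq_mul i j hij]
    · simp [F, hij.symm]
    · intro k _ hk
      simp [F, hk.1, hk.2]
    · simp
    · simp
  have h2 : ∏ k, ∫ u, F k u = (∫ u, f u) * ∫ u, g u := by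
    rw [Finset.prod_eq_mul i j hij]
    · simp [F, hij.symm]
    · intro k _ hk
      simp [F, hk.1, hk.2]
    · simp
    · simp
  rw [inner_oneLp, inner_oneLp, ← h2, ← integral_fintype_prod_volume_eq_prod, L2.inner_def]
  refine integral_congr_ae ?_
  filter_upwards [coeFn_coordLift i f, coeFn_coordLift j g] with t h3 h4
  rw [h3, h4, h1, RCLike.inner_apply, RCLike.conj_to_real, mul_comm]

theorem inner_oneLp_coordLift (j : Fin d) (f : Lp ℝ 2 (volume : Measure T)) :
    ⟪oneLp (Fin d → T), coordLift j f⟫_ℝ = ⟪oneLp T, f⟫_ℝ := by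
  rw [← coordLift_oneLp j, LinearIsometry.inner_map_map]

/-- The adjoint of `coordLift`. -/
noncomputable def coordMargin (j : Fin d) :
    Lp ℝ 2 (volume : Measure (Fin d → T)) →L[ℝ] Lp ℝ 2 (volume : Measure T) :=
  ContinuousLinearMap.adjoint (coordLift j).toContinuousLinearMap

theorem inner_coordMargin (j : Fin d) (f : Lp ℝ 2 (volume : Measure T))
    (g : Lp ℝ 2 (volume : Measure (Fin d → T))) :
    ⟪f, coordMargin j g⟫_ℝ = ⟪coordLift j f, g⟫_ℝ :=
  ContinuousLinearMap.adjoint_inner_right _ _ _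

/-- Being the adjoint of the lift, `coordMargin` integrates out the other coordinates. This reduces
an additive kernel to its marginal operators. -/
theorem integral_coord_mul (j : Fin d) {c : T → ℝ} (hc : MemLp c 2 volume)
    (f : Lp ℝ 2 (volume : Measure (Fin d → T))) :
    Integrable (fun s => c (s j) * f s) ∧
      ∫ s, c (s j) * f s = ∫ u, c u * coordMargin j f u := by
  have h1 : coordLift j (hc.toLp c) =ᵐ[volume] fun t => c (t j) := by
    filter_upwards [coeFn_coordLift j (hc.toLp c), ae_coord j hc.coeFn_toLp] with t h1 h2
    rw [h1, h2]
  have h2 := inner_coordMargin j (hc.toLp c) f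
  rw [L2.inner_def, L2.inner_def] at h2
  constructor
  · refine (L2.integrable_inner (𝕜 := ℝ) (coordLift j (hc.toLp c)) f).congr ?_
    filter_upwards [h1] with t ht
    rw [ht, RCLike.inner_apply, RCLike.conj_to_real, mul_comm]
  · calc ∫ s, c (s j) * f s = ∫ s, ⟪coordLift j (hc.toLp c) s, f s⟫_ℝ := by
          refine integral_congr_ae ?_
          filter_upwards [h1] with t ht
          rw [ht, RCLike.inner_apply, RCLike.conj_to_real, mul_comm]
      _ = ∫ u, ⟪hc.toLp c u, coordMargin j f u⟫_ℝ := h2.symm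
      _ = ∫ u, c u * coordMargin j f u := by
          refine integral_congr_ae ?_
          filter_upwards [hc.coeFn_toLp] with t ht
          rw [ht, RCLike.inner_apply, RCLike.conj_to_real, mul_comm]

theorem hasSum_sigma_of_nonneg {ι : Type*} [Fintype ι] {B : ι → Type*} {f : (Σ i, B i) → ℝ}
    (hf : ∀ p, 0 ≤ f p) {a : ι → ℝ} (h : ∀ i, HasSum (fun k => f ⟨i, k⟩) (a i)) :
    HasSum f (∑ i, a i) := by
  have hs : Summable f := (summable_sigma_of_nonneg hf).2
    ⟨fun i => (h i).summable, (hasSum_fintype _).summable⟩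
  have h1 := hs.hasSum
  rwa [hs.tsum_sigma' fun i => (h i).summable, tsum_fintype,
    Finset.sum_congr rfl fun i _ => (h i).tsum_eq] at h1

variable {Ω : Type*} [MeasurableSpace Ω] {P : Measure Ω} [IsProbabilityMeasure P]

/-- The eigenvectors of the covariance operator of an additive random field. -/
noncomputable def additiveVec {C : Fin d → T → T → ℝ}
    (φ : ∀ j, {k // 0 < remEigenvalue (C j) k} → Lp ℝ 2 (volume : Measure T)) :
    (Σ j, {k // 0 < remEigenvalue (C j) k}) ⊕ Unit → Lp ℝ 2 (volume : Measure (Fin d → T)) :=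
  Sum.elim (fun p => coordLift p.1 (φ p.1 p.2)) fun _ => oneLp (Fin d → T)

/-- The eigenvalues of the covariance operator of an additive random field. -/
noncomputable def additiveVal (C : Fin d → T → T → ℝ) (r : Fin d → ℝ) :
    (Σ j, {k // 0 < remEigenvalue (C j) k}) ⊕ Unit → ℝ :=
  Sum.elim (fun p => remEigenvalue (C p.1) p.2) fun _ => ∑ j, r j

/-- The quadratic form at `f` is `∑ ⟪K j f_j, f_j⟫` with `f_j = coordMargin j f`. All `f_j` have the
same mean `⟪1, f⟫`, so the terms `r j * ⟪1, f_j⟫²` merge into one eigenvalue `∑ r j` at the constant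
function. -/
theorem fieldSpectrum_additive {C : Fin d → T → T → ℝ} {r : Fin d → ℝ}
    {K : Fin d → Lp ℝ 2 (volume : Measure T) →L[ℝ] Lp ℝ 2 (volume : Measure T)}
    {φ : ∀ j, {k // 0 < remEigenvalue (C j) k} → Lp ℝ 2 (volume : Measure T)}
    (hM : ∀ j, MarginalSpectrum (C j) (r j) (K j) (φ j)) (hC : ∀ j u, MemLp (C j u) 2 volume)
    {Y : (Fin d → T) → Ω → ℝ} (hY : IsField P Y)
    (hcov : ∀ t s, covFun P Y t s = ∑ j, C j (t j) (s j)) :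
    FieldSpectrum P Y (additiveVec φ) (additiveVal C r) where
  isField := hY
  orthonormal := by
    classical
    rw [orthonormal_iff_ite]
    rintro (⟨i, k⟩ | u) (⟨j, m⟩ | v)
    · by_cases hij : i = j
      · subst hij
        simp only [additiveVec, Sum.elim_inl, LinearIsometry.inner_map_map]
        rw [orthonormal_iff_ite.1 (hM i).orthonormal k m]
        simp
      · simp only [additiveVec, Sum.elim_inl]
        rw [inner_coordLift_of_ne hij, (hM i).inner_one, zero_mul, if_neg]
        simp [hij]
    · simp only [additiveVec, Sum.elim_inl, Sum.elim_inr]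
      rw [real_inner_comm, inner_oneLp_coordLift, (hM i).inner_one]
      simp
    · simp only [additiveVec, Sum.elim_inl, Sum.elim_inr]
      rw [inner_oneLp_coordLift, (hM j).inner_one]
      simp
    · simp [additiveVec, norm_oneLp]
  nonneg := by
    rintro (p | u)
    · exact p.2.2.le
    · exact Finset.sum_nonneg (s := Finset.univ) (f := r) fun j _ => (hM j).nonneg
  hasSum f := by
    have h1 : ∀ j, HasSum (fun k : {k // 0 < remEigenvalue (C j) k} => remEigenvalue (C j) k *
        ⟪coordLift j (φ j k), f⟫_ℝ ^ 2) (⟪K j (coordMargin j f), coordMargin j f⟫_ℝ -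
          r j * ⟪oneLp (Fin d → T), f⟫_ℝ ^ 2) := fun j => by
      have := (hM j).hasSum (coordMargin j f)
      simpa only [inner_coordMargin, coordLift_oneLp] using this
    have h2 : HasSum (fun p : Σ j, {k // 0 < remEigenvalue (C j) k} =>
        remEigenvalue (C p.1) p.2 * ⟪coordLift p.1 (φ p.1 p.2), f⟫_ℝ ^ 2)
        (∑ j, (⟪K j (coordMargin j f), coordMargin j f⟫_ℝ -
          r j * ⟪oneLp (Fin d → T), f⟫_ℝ ^ 2)) :=
      hasSum_sigma_of_nonneg (fun p => mul_nonneg p.2.2.le (sq_nonneg _)) h1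
    have h3 : HasSum (fun i => additiveVal C r i * ⟪additiveVec φ i, f⟫_ℝ ^ 2) _ := HasSum.sum h2
      (hasSum_unique fun _ : Unit => (∑ j, r j) * ⟪oneLp (Fin d → T), f⟫_ℝ ^ 2)
    convert h3 using 1
    rw [hY.integral_inner_sq, Finset.sum_sub_distrib, Finset.sum_mul, sub_add_cancel]
    have h4 : ∀ t, integralOp (covFun P Y) f t = ∑ j, integralOp (C j) (coordMargin j f) (t j) := by
      intro t
      simp only [integralOp, hcov, Finset.sum_mul]
      rw [integral_finsetSum _ fun j _ => (integral_coord_mul j (hC j (t j)) f).1]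
      exact Finset.sum_congr rfl fun j _ => (integral_coord_mul j (hC j (t j)) f).2
    have h5 : ∀ j, (fun t : Fin d → T => f t * integralOp (C j) (coordMargin j f) (t j)) =ᵐ[volume]
        fun t => K j (coordMargin j f) (t j) * f t := fun j => by
      filter_upwards [ae_coord j ((hM j).coeFn_apply (coordMargin j f))] with t ht
      rw [ht, mul_comm]
    have h6 := fun j => integral_coord_mul j (Lp.memLp (K j (coordMargin j f))) f
    simp only [h4, Finset.mul_sum]
    rw [integral_finsetSum _ fun j _ => (h6 j).1.congr (h5 j).symm]
    refine Finset.sum_congr rfl fun j _ => ?_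
    rw [integral_congr_ae (h5 j), (h6 j).2, L2.inner_def]
    refine integral_congr_ae (Eventually.of_forall fun u => ?_)
    simp only [RCLike.inner_apply, RCLike.conj_to_real, mul_comm]

end Lift

/-! ### Distribution functions and generalized inverses -/

section Dist

theorem exists_continuousAt_Ioo {F : ℝ → ℝ} (hF : Monotone F) {x y : ℝ} (hxy : x < y) :
    ∃ z, x < z ∧ z < y ∧ ContinuousAt F z := by
  have h1 : Dense {z | ¬ ContinuousAt F z}ᶜ := hF.countable_not_continuousAt.dense_compl ℝ
  obtain ⟨z, hz, hz'⟩ := h1.exists_between hxy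
  exact ⟨z, hz'.1, hz'.2, not_not.1 hz⟩

theorem IsDistFun.monotone_signedDist {W : ℝ → ℝ} (hW : IsDistFun W) (s : ℝ) :
    Monotone (signedDist s W) := by
  intro x y hxy
  unfold signedDist
  split_ifs
  · exact hW.mono hxy
  · exact sub_le_sub_left (hW.mono.leftLim (neg_le_neg hxy)) 1

theorem IsDistFun.tendsto_signedDist_bot {W : ℝ → ℝ} (hW : IsDistFun W) (s : ℝ) :
    Tendsto (signedDist s W) atBot (𝓝 0) := by
  unfold signedDist
  split_ifs
  · exact hW.tendsto_bot
  · have h1 : Tendsto (Function.leftLim W) atTop (𝓝 1) := by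
      refine tendsto_of_tendsto_of_tendsto_of_le_of_le
        (hW.tendsto_top.comp (tendsto_atTop_add_const_right atTop (-1) tendsto_id))
        hW.tendsto_top (fun x => ?_) (fun x => hW.mono.leftLim_le le_rfl)
      exact hW.mono.le_leftLim (by simp)
    simpa using (h1.comp tendsto_neg_atBot_atTop).const_sub 1

theorem IsDistFun.tendsto_signedDist_top {W : ℝ → ℝ} (hW : IsDistFun W) (s : ℝ) :
    Tendsto (signedDist s W) atTop (𝓝 1) := by
  unfold signedDist
  split_ifs
  · exact hW.tendsto_top
  · have h1 : Tendsto (Function.leftLim W) atBot (𝓝 0) := by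
      refine tendsto_of_tendsto_of_tendsto_of_le_of_le
        (hW.tendsto_bot.comp (tendsto_atBot_add_const_right atBot (-1) tendsto_id))
        hW.tendsto_bot (fun x => ?_) (fun x => hW.mono.leftLim_le le_rfl)
      exact hW.mono.le_leftLim (by simp)
    simpa using (h1.comp tendsto_neg_atTop_atBot).const_sub 1

theorem bddBelow_setOf_le {F : ℝ → ℝ} (hF : Monotone F) (hbot : Tendsto F atBot (𝓝 0)) {y : ℝ}
    (hy : 0 < y) : BddBelow {x | y ≤ F x} := by
  obtain ⟨m, hm⟩ := (hbot.eventually (gt_mem_nhds hy)).exists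
  refine ⟨m, fun x hx => ?_⟩
  by_contra! hlt
  exact absurd (lt_of_le_of_lt (le_trans hx (hF hlt.le)) hm) (lt_irrefl _)

theorem lt_of_lt_genInv {F : ℝ → ℝ} (hF : Monotone F) (hbot : Tendsto F atBot (𝓝 0)) {x y : ℝ}
    (hy : 0 < y) (hx : x < genInv F y) : F x < y := by
  by_contra! hle
  exact absurd (csInf_le (bddBelow_setOf_le hF hbot hy) hle) (not_le.2 hx)

/-- Continuity at `y` excludes a plateau of `F` at height `y`: if `F x ≤ y`, then the inverse is at
least `x` at every level in `(y, 1)`, so it would jump at `y`. -/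
theorem lt_of_genInv_lt {F : ℝ → ℝ} (hF : Monotone F)
    (htop : Tendsto F atTop (𝓝 1)) {x y : ℝ} (hy1 : y < 1)
    (hc : ContinuousAt (genInv F) y) (hx : genInv F y < x) : y < F x := by
  by_contra! hle
  have h1 : ∀ᶠ y' in 𝓝[>] y, genInv F y' < x :=
    (hc.tendsto.mono_left nhdsWithin_le_nhds).eventually (gt_mem_nhds hx)
  have h2 : ∀ᶠ y' in 𝓝[>] y, y' < 1 :=
    (eventually_lt_nhds hy1).filter_mono nhdsWithin_le_nhds
  obtain ⟨y', ⟨h1, h2⟩, h3⟩ := ((h1.and h2).and self_mem_nhdsWithin).exists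
  have h3 : y < y' := h3
  refine absurd h1 (not_lt.2 (le_csInf ?_ fun z hz => ?_))
  · obtain ⟨z, hz⟩ := (htop.eventually (lt_mem_nhds h2)).exists
    exact ⟨z, hz.le⟩
  · by_contra! hlt
    have hz : y' ≤ F z := hz
    linarith [hF hlt.le]

end Dist

/-! ### Asymptotics of the distribution of the eigenvalues -/

section Asymp

variable {lam : ℕ → ℕ → ℝ} {Lam : ℕ → ℝ}

/-- The sum of the numbers `lam j k`, `j < d`, that are at least `θ`. -/
noncomputable def largeSum (lam : ℕ → ℕ → ℝ) (d : ℕ) (θ : ℝ) : ℝ :=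
  ∑ j ∈ Finset.range d, ∑' k, lam j k * (if θ ≤ lam j k then 1 else 0)

/-- The part of the sum of `lam j k` that belongs to the values with `-ln (lam j k) - ℓ j ≤ x`. -/
noncomputable def shiftedSum (lam : ℕ → ℕ → ℝ) (ℓ : ℕ → ℝ) (j : ℕ) (x : ℝ) : ℝ :=
  ∑' k, lam j k * (if -Real.log (lam j k) - ℓ j ≤ x then 1 else 0)

/-- The condition `λ ≥ e^{-t}` is `-ln λ ≤ t`, and the shift by `ℓ j` cancels. A zero entry is
harmless despite `Real.log 0 = 0`, because it carries weight zero. -/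
theorem largeSum_exp (h0 : ∀ j k, 0 ≤ lam j k) (ℓ : ℕ → ℝ) (d : ℕ) (t : ℝ) :
    largeSum lam d (Real.exp (-t)) = ∑ j ∈ Finset.range d, shiftedSum lam ℓ j (t - ℓ j) := by
  refine Finset.sum_congr rfl fun j _ => tsum_congr fun k => ?_
  rcases (h0 j k).eq_or_lt with h | h
  · simp [← h]
  · congr 1
    refine if_congr ?_ rfl rfl
    rw [← Real.le_log_iff_exp_le h]
    constructor <;> intro <;> linarith

theorem summable_mul_ite (h0 : ∀ j k, 0 ≤ lam j k)
    (hs : ∀ j, HasSum (lam j) (Lam j)) (j : ℕ) (p : ℕ → Prop) [DecidablePred p] :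
    Summable fun k => lam j k * (if p k then 1 else 0) :=
  (hs j).summable.of_nonneg_of_le (fun k => mul_nonneg (h0 j k) (by split_ifs <;> norm_num))
    fun k => mul_le_of_le_one_right (h0 j k) (by split_ifs <;> norm_num)

theorem Lam_nonneg (h0 : ∀ j k, 0 ≤ lam j k)
    (hs : ∀ j, HasSum (lam j) (Lam j)) (j : ℕ) : 0 ≤ Lam j := (hs j).nonneg (h0 j)

theorem shiftedSum_nonneg (h0 : ∀ j k, 0 ≤ lam j k) (ℓ : ℕ → ℝ) (j : ℕ) (x : ℝ) :
    0 ≤ shiftedSum lam ℓ j x :=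
  tsum_nonneg fun k => mul_nonneg (h0 j k) (by split_ifs <;> norm_num)

theorem shiftedSum_le (h0 : ∀ j k, 0 ≤ lam j k)
    (hs : ∀ j, HasSum (lam j) (Lam j)) (ℓ : ℕ → ℝ) (j : ℕ) (x : ℝ) : shiftedSum lam ℓ j x ≤ Lam j :=
  hasSum_le (fun k => mul_le_of_le_one_right (h0 j k) (by split_ifs <;> norm_num))
    (summable_mul_ite h0 hs j _).hasSum (hs j)

theorem shiftedSum_mono (h0 : ∀ j k, 0 ≤ lam j k)
    (hs : ∀ j, HasSum (lam j) (Lam j)) (ℓ : ℕ → ℝ) (j : ℕ) : Monotone (shiftedSum lam ℓ j) := by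
  intro x y hxy
  refine (summable_mul_ite h0 hs j _).tsum_le_tsum (fun k => ?_) (summable_mul_ite h0 hs j _)
  refine mul_le_mul_of_nonneg_left ?_ (h0 j k)
  split_ifs with h1 h2
  · exact le_rfl
  · exact absurd (h1.trans hxy) h2
  · norm_num
  · exact le_rfl

/-- Half of the tightness of the normalized spectra; the next lemma is the other half. Multiplied
out, the bound also covers `Lam j = 0`, where the normalized sum is a division by zero. -/
theorem exists_le_shiftedSum (h0 : ∀ j k, 0 ≤ lam j k)
    (hs : ∀ j, HasSum (lam j) (Lam j)) {ℓ : ℕ → ℝ} {U : ℝ → ℝ}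
    (hU : IsDistFun U)
    (hUconv : ∀ x, ContinuousAt U x →
      Tendsto (fun j => (1 / Lam j) * shiftedSum lam ℓ j x) atTop (𝓝 (U x)))
    {δ : ℝ} (hδ : 0 < δ) :
    ∃ M J, ∀ j, J ≤ j → (1 - δ) * Lam j ≤ shiftedSum lam ℓ j M := by
  obtain ⟨m, hm⟩ := (hU.tendsto_top.eventually (lt_mem_nhds (by linarith : 1 - δ < 1))).exists
  obtain ⟨M, hM, -, hc⟩ := exists_continuousAt_Ioo hU.mono (lt_add_one m)
  obtain ⟨J, hJ⟩ := eventually_atTop.1 ((hUconv M hc).eventually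
    (lt_mem_nhds (hm.trans_le (hU.mono hM.le))))
  refine ⟨M, J, fun j hj => ?_⟩
  rcases (Lam_nonneg h0 hs j).eq_or_lt with h | h
  · rw [← h, mul_zero]
    exact shiftedSum_nonneg h0 ℓ j M
  · have := hJ j hj
    rw [one_div, inv_mul_eq_div, lt_div_iff₀ h] at this
    exact this.le

theorem exists_shiftedSum_le (h0 : ∀ j k, 0 ≤ lam j k)
    (hs : ∀ j, HasSum (lam j) (Lam j)) {ℓ : ℕ → ℝ} {U : ℝ → ℝ}
    (hU : IsDistFun U)
    (hUconv : ∀ x, ContinuousAt U x →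
      Tendsto (fun j => (1 / Lam j) * shiftedSum lam ℓ j x) atTop (𝓝 (U x)))
    {δ : ℝ} (hδ : 0 < δ) :
    ∃ M J, ∀ j, J ≤ j → shiftedSum lam ℓ j M ≤ δ * Lam j := by
  obtain ⟨m, hm⟩ := (hU.tendsto_bot.eventually (gt_mem_nhds hδ)).exists
  obtain ⟨M, -, hM, hc⟩ := exists_continuousAt_Ioo hU.mono (sub_one_lt m)
  obtain ⟨J, hJ⟩ := eventually_atTop.1 ((hUconv M hc).eventually
    (gt_mem_nhds ((hU.mono hM.le).trans_lt hm)))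
  refine ⟨M, J, fun j hj => ?_⟩
  rcases (Lam_nonneg h0 hs j).eq_or_lt with h | h
  · have := shiftedSum_le h0 hs ℓ j M
    rw [← h] at this ⊢
    simpa using this
  · have := hJ j hj
    rw [one_div, inv_mul_eq_div, div_lt_iff₀ h] at this
    exact this.le

/-- For large `d` the sum of the large `lam j k` is almost at least the sum of the weights
`Lam j` with `ℓ j ≤ t`. -/
theorem eventually_le_largeSum (h0 : ∀ j k, 0 ≤ lam j k)
    (hs : ∀ j, HasSum (lam j) (Lam j)) {ℓ : ℕ → ℝ} {U : ℝ → ℝ}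
    (hU : IsDistFun U)
    (hUconv : ∀ x, ContinuousAt U x →
      Tendsto (fun j => (1 / Lam j) * shiftedSum lam ℓ j x) atTop (𝓝 (U x)))
    (hL : Tendsto (fun d => ∑ j ∈ Finset.range d, Lam j) atTop atTop)
    {b : ℕ → ℝ} (hb : Tendsto b atTop atTop) {η δ : ℝ} (hη : 0 < η) (hδ : 0 < δ) :
    ∀ᶠ d in atTop, ∀ t, (∑ j ∈ Finset.range d, Lam j * (if ℓ j ≤ t then 1 else 0)) -
      δ * ∑ j ∈ Finset.range d, Lam j ≤ largeSum lam d (Real.exp (-(t + η * b d))) := by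
  obtain ⟨M, J, hM⟩ := exists_le_shiftedSum h0 hs hU hUconv (half_pos hδ)
  filter_upwards [hL.eventually_ge_atTop ((∑ j ∈ Finset.range J, Lam j) / (δ / 2)),
    (hb.const_mul_atTop hη).eventually_ge_atTop M, eventually_ge_atTop J] with d h1 h2 h3 t
  rw [div_le_iff₀ (half_pos hδ)] at h1
  rw [largeSum_exp h0 ℓ]
  -- For `j ≥ J` with `ℓ j ≤ t`, the argument is at least `η * b d ≥ M`, so at most the share `δ /
  -- 2` is lost. The blocks `j < J` are given up entirely; by the choice of `d` they cost at most
  -- another `δ / 2` of the total.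
  have h4 : ∀ j, Lam j * (if ℓ j ≤ t then 1 else 0) ≤
      shiftedSum lam ℓ j (t + η * b d - ℓ j) + δ / 2 * Lam j + if j < J then Lam j else 0 := by
    intro j
    have hj := Lam_nonneg h0 hs j
    have hj2 := shiftedSum_nonneg h0 ℓ j (t + η * b d - ℓ j)
    have hj3 : 0 ≤ δ / 2 * Lam j := by positivity
    by_cases hjJ : j < J
    · rw [if_pos hjJ]
      split_ifs <;> linarith
    · rw [if_neg hjJ]
      split_ifs with ht
      · have h5 := hM j (not_lt.1 hjJ)
        have h6 := shiftedSum_mono h0 hs ℓ j (by linarith : M ≤ t + η * b d - ℓ j)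
        linarith
      · linarith
  have h5 := Finset.sum_le_sum fun j (_ : j ∈ Finset.range d) => h4 j
  rw [Finset.sum_add_distrib, Finset.sum_add_distrib, ← Finset.mul_sum, ← Finset.sum_filter] at h5
  have h6 : (Finset.range d).filter (· < J) = Finset.range J := by
    ext j; simp only [Finset.mem_filter, Finset.mem_range]; omega
  rw [h6] at h5
  linarith

/-- The converse estimate of `eventually_le_largeSum`. -/
theorem eventually_largeSum_le (h0 : ∀ j k, 0 ≤ lam j k)
    (hs : ∀ j, HasSum (lam j) (Lam j)) {ℓ : ℕ → ℝ} {U : ℝ → ℝ}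
    (hU : IsDistFun U)
    (hUconv : ∀ x, ContinuousAt U x →
      Tendsto (fun j => (1 / Lam j) * shiftedSum lam ℓ j x) atTop (𝓝 (U x)))
    (hL : Tendsto (fun d => ∑ j ∈ Finset.range d, Lam j) atTop atTop)
    {b : ℕ → ℝ} (hb : Tendsto b atTop atTop) {η δ : ℝ} (hη : 0 < η) (hδ : 0 < δ) :
    ∀ᶠ d in atTop, ∀ t, largeSum lam d (Real.exp (-(t - η * b d))) ≤
      (∑ j ∈ Finset.range d, Lam j * (if ℓ j ≤ t then 1 else 0)) +
        δ * ∑ j ∈ Finset.range d, Lam j := by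
  obtain ⟨M, J, hM⟩ := exists_shiftedSum_le h0 hs hU hUconv (half_pos hδ)
  filter_upwards [hL.eventually_ge_atTop ((∑ j ∈ Finset.range J, Lam j) / (δ / 2)),
    (hb.const_mul_atTop hη).eventually_ge_atTop (-M), eventually_ge_atTop J] with d h1 h2 h3 t
  rw [div_le_iff₀ (half_pos hδ)] at h1
  rw [largeSum_exp h0 ℓ]
  have h4 : ∀ j, shiftedSum lam ℓ j (t - η * b d - ℓ j) ≤
      Lam j * (if ℓ j ≤ t then 1 else 0) + δ / 2 * Lam j + if j < J then Lam j else 0 := by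
    intro j
    have hj := Lam_nonneg h0 hs j
    have hj2 := shiftedSum_le h0 hs ℓ j (t - η * b d - ℓ j)
    have hj3 : 0 ≤ δ / 2 * Lam j := by positivity
    by_cases hjJ : j < J
    · rw [if_pos hjJ]
      split_ifs <;> linarith
    · rw [if_neg hjJ]
      split_ifs with ht
      · linarith
      · have h5 := hM j (not_lt.1 hjJ)
        have h6 := shiftedSum_mono h0 hs ℓ j (by linarith : t - η * b d - ℓ j ≤ M)
        linarith
  have h5 := Finset.sum_le_sum fun j (_ : j ∈ Finset.range d) => h4 j
  rw [Finset.sum_add_distrib, Finset.sum_add_distrib, ← Finset.mul_sum, ← Finset.sum_filter] at h5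
  have h6 : (Finset.range d).filter (· < J) = Finset.range J := by
    ext j; simp only [Finset.mem_filter, Finset.mem_range]; omega
  rw [h6] at h5
  linarith

/-- The distribution of the weights, in terms of `ℓ` itself instead of `sgn * ℓ`. -/
theorem eventually_weights (hLam : ∀ j, 0 ≤ Lam j) {ℓ : ℕ → ℝ} {s : ℝ} (hsgn : s = 1 ∨ s = -1)
    (hL : Tendsto (fun d => ∑ j ∈ Finset.range d, Lam j) atTop atTop)
    {W : ℝ → ℝ} (hW : IsDistFun W) {a b : ℕ → ℝ} (hb : Tendsto b atTop atTop)
    (hWconv : ∀ x, ContinuousAt W x →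
      Tendsto (fun d : ℕ =>
        (∑ j ∈ Finset.range d, Lam j * (if s * (ℓ j - a d) ≤ x * b d then 1 else 0)) /
          ∑ j ∈ Finset.range d, Lam j) atTop (𝓝 (W x)))
    (x : ℝ) {η δ : ℝ} (hη : 0 < η) (hδ : 0 < δ) :
    (∀ᶠ d in atTop, (signedDist s W x - δ) * ∑ j ∈ Finset.range d, Lam j ≤
      ∑ j ∈ Finset.range d, Lam j * (if ℓ j ≤ a d + (x + η) * b d then 1 else 0)) ∧
    ∀ᶠ d in atTop,
      ∑ j ∈ Finset.range d, Lam j * (if ℓ j ≤ a d + (x - η) * b d then 1 else 0) ≤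
        (signedDist s W x + δ) * ∑ j ∈ Finset.range d, Lam j := by
  have hge : ∀ z v, ContinuousAt W z → v < W z → ∀ᶠ d in atTop,
      v * ∑ j ∈ Finset.range d, Lam j ≤
        ∑ j ∈ Finset.range d, Lam j * (if s * (ℓ j - a d) ≤ z * b d then 1 else 0) := by
    intro z v hz hv
    filter_upwards [(hWconv z hz).eventually (lt_mem_nhds hv), hL.eventually_gt_atTop 0]
      with d h1 h2
    rw [lt_div_iff₀ h2] at h1
    exact h1.le
  have hle : ∀ z v, ContinuousAt W z → W z < v → ∀ᶠ d in atTop,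
      ∑ j ∈ Finset.range d, Lam j * (if s * (ℓ j - a d) ≤ z * b d then 1 else 0) ≤
        v * ∑ j ∈ Finset.range d, Lam j := by
    intro z v hz hv
    filter_upwards [(hWconv z hz).eventually (gt_mem_nhds hv), hL.eventually_gt_atTop 0]
      with d h1 h2
    rw [div_lt_iff₀ h2] at h1
    exact h1.le
  rcases hsgn with rfl | rfl
  · simp only [signedDist, if_true]
    constructor
    · obtain ⟨z, hz1, hz2, hc⟩ := exists_continuousAt_Ioo hW.mono (lt_add_of_pos_right x hη)
      filter_upwards [hge z (W x - δ) hc (by linarith [hW.mono hz1.le]),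
        hb.eventually_gt_atTop 0] with d h1 h2
      refine h1.trans (Finset.sum_le_sum fun j _ => mul_le_mul_of_nonneg_left ?_ (hLam j))
      split_ifs with h3 h4
      · exact le_rfl
      · exact absurd (by nlinarith) h4
      · norm_num
      · exact le_rfl
    · obtain ⟨z, hz1, hz2, hc⟩ := exists_continuousAt_Ioo hW.mono (sub_lt_self x hη)
      filter_upwards [hle z (W x + δ) hc (by linarith [hW.mono hz2.le]),
        hb.eventually_gt_atTop 0] with d h1 h2
      refine le_trans (Finset.sum_le_sum fun j _ => mul_le_mul_of_nonneg_left ?_ (hLam j)) h1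
      split_ifs with h3 h4
      · exact le_rfl
      · exact absurd (by nlinarith) h4
      · norm_num
      · exact le_rfl
  · have h1 : (-1 : ℝ) ≠ 1 := by norm_num
    simp only [signedDist, if_neg h1]
    -- For `s = -1` a half-line for `ℓ j` becomes, up to the slack `η`, the complement of one for
    -- `-(ℓ j - a d)`. Continuity points `z` on either side of `-x` are compared with the left limit
    -- there.
    have hcompl : ∀ d z, ∑ j ∈ Finset.range d, Lam j * (1 -
        (if -1 * (ℓ j - a d) ≤ z * b d then 1 else 0)) = ∑ j ∈ Finset.range d, Lam j -
        ∑ j ∈ Finset.range d, Lam j * (if -1 * (ℓ j - a d) ≤ z * b d then 1 else 0) := by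
      intro d z
      rw [← Finset.sum_sub_distrib]
      exact Finset.sum_congr rfl fun j _ => by ring
    constructor
    · obtain ⟨z, hz1, hz2, hc⟩ := exists_continuousAt_Ioo hW.mono (sub_lt_self (-x) hη)
      filter_upwards [hle z (Function.leftLim W (-x) + δ) hc
        (by linarith [hW.mono.le_leftLim hz2]), hb.eventually_gt_atTop 0] with d h1 h2
      have h3 : ∑ j ∈ Finset.range d, Lam j * (1 -
          (if -1 * (ℓ j - a d) ≤ z * b d then 1 else 0)) ≤
          ∑ j ∈ Finset.range d, Lam j * (if ℓ j ≤ a d + (x + η) * b d then 1 else 0) := by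
        refine Finset.sum_le_sum fun j _ => mul_le_mul_of_nonneg_left ?_ (hLam j)
        split_ifs with h3 h4
        · norm_num
        · norm_num
        · norm_num
        · exact absurd (by nlinarith) h3
      rw [hcompl] at h3
      linarith
    · obtain ⟨z, hz1, hz2, hc⟩ := exists_continuousAt_Ioo hW.mono (lt_add_of_pos_right (-x) hη)
      filter_upwards [hge z (Function.leftLim W (-x) - δ) hc
        (by linarith [hW.mono.leftLim_le hz1.le]), hb.eventually_gt_atTop 0] with d h1 h2
      have h3 : ∑ j ∈ Finset.range d, Lam j * (if ℓ j ≤ a d + (x - η) * b d then 1 else 0) ≤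
          ∑ j ∈ Finset.range d, Lam j * (1 -
          (if -1 * (ℓ j - a d) ≤ z * b d then 1 else 0)) := by
        refine Finset.sum_le_sum fun j _ => mul_le_mul_of_nonneg_left ?_ (hLam j)
        split_ifs with h3 h4
        · exact absurd h4 (by nlinarith)
        · norm_num
        · norm_num
        · norm_num
      rw [hcompl] at h3
      linarith

/-- The real-analysis core: `τ d` is the admissible squared error, and `hn` packages the two-sided
bound on the complexity. The thresholds are taken at `q ± 2η` on the scale `b d`, where `S / L` is
strictly on the right side of `y`. -/
theorem isLittleO_log_complexity (h0 : ∀ j k, 0 ≤ lam j k)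
    (hs : ∀ j, HasSum (lam j) (Lam j)) {ℓ : ℕ → ℝ} {U : ℝ → ℝ}
    (hU : IsDistFun U)
    (hUconv : ∀ x, ContinuousAt U x →
      Tendsto (fun j => (1 / Lam j) * shiftedSum lam ℓ j x) atTop (𝓝 (U x)))
    (hL : Tendsto (fun d => ∑ j ∈ Finset.range d, Lam j) atTop atTop)
    {s : ℝ} (hsgn : s = 1 ∨ s = -1)
    {W : ℝ → ℝ} (hW : IsDistFun W) {a b : ℕ → ℝ} (hb : Tendsto b atTop atTop)
    (hWconv : ∀ x, ContinuousAt W x →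
      Tendsto (fun d : ℕ =>
        (∑ j ∈ Finset.range d, Lam j * (if s * (ℓ j - a d) ≤ x * b d then 1 else 0)) /
          ∑ j ∈ Finset.range d, Lam j) atTop (𝓝 (W x)))
    {y : ℝ} (hy0 : 0 < y) (hy1 : y < 1) {τ : ℕ → ℝ}
    (hτ : Tendsto (fun d => 1 - τ d / ∑ j ∈ Finset.range d, Lam j) atTop (𝓝 y))
    (hc : ContinuousAt (genInv (signedDist s W)) y) {n : ℕ → ℕ}
    (hn : ∀ d θ, 0 < θ → 0 < largeSum lam d θ →
      ∑ j ∈ Finset.range d, Lam j - largeSum lam d θ ≤ τ d →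
      (n d : ℝ) ≤ 2 * (largeSum lam d θ / θ) ∧ 1 ≤ n d ∧
        ∀ θ', 0 < θ' → ∑ j ∈ Finset.range d, Lam j - (largeSum lam d θ' + n d * θ') ≤ τ d) :
    (fun d : ℕ => Real.log (n d : ℝ) - (Real.log (∑ j ∈ Finset.range d, Lam j) + a d +
        genInv (signedDist s W) y * b d)) =o[atTop] b := by
  set F := signedDist s W
  set q := genInv F y
  have hLam := Lam_nonneg h0 hs
  have hupper : ∀ x η δ : ℝ, 0 < η → 0 < δ → ∀ᶠ d in atTop,
      (F x - δ) * ∑ j ∈ Finset.range d, Lam j ≤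
        largeSum lam d (Real.exp (-(a d + (x + η) * b d))) := by
    intro x η δ hη hδ
    filter_upwards [(eventually_weights hLam hsgn hL hW hb hWconv x (half_pos hη)
      (half_pos hδ)).1, eventually_le_largeSum h0 hs hU hUconv hL hb (half_pos hη)
      (half_pos hδ)] with d h1 h2
    have h3 := h2 (a d + (x + η / 2) * b d)
    have h4 : a d + (x + η / 2) * b d + η / 2 * b d = a d + (x + η) * b d := by ring
    rw [h4] at h3
    linarith
  have hlower : ∀ x η δ : ℝ, 0 < η → 0 < δ → ∀ᶠ d in atTop,
      largeSum lam d (Real.exp (-(a d + (x - η) * b d))) ≤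
        (F x + δ) * ∑ j ∈ Finset.range d, Lam j := by
    intro x η δ hη hδ
    filter_upwards [(eventually_weights hLam hsgn hL hW hb hWconv x (half_pos hη)
      (half_pos hδ)).2, eventually_largeSum_le h0 hs hU hUconv hL hb (half_pos hη)
      (half_pos hδ)] with d h1 h2
    have h3 := h2 (a d + (x - η / 2) * b d)
    have h4 : a d + (x - η / 2) * b d - η / 2 * b d = a d + (x - η) * b d := by ring
    rw [h4] at h3
    linarith
  rw [isLittleO_iff]
  intro c hc0
  -- Of the `3 * η`, two are the shift of the threshold and one absorbs the constants `log 2` and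
  -- `-log δ'`.
  obtain ⟨η, hη, hηc⟩ : ∃ η, 0 < η ∧ 3 * η = c := ⟨c / 3, by positivity, by ring⟩
  have hFq : y < F (q + η) := lt_of_genInv_lt (hW.monotone_signedDist s)
    (hW.tendsto_signedDist_top s) hy1 hc (lt_add_of_pos_right q hη)
  have hFq' : F (q - η) < y := lt_of_lt_genInv (hW.monotone_signedDist s)
    (hW.tendsto_signedDist_bot s) hy0 (sub_lt_self q hη)
  -- The gap above `y` pays for the error in `S` and for the convergence of `τ / L`. The gap below
  -- has a third share, left over to force `n d * θ' ≥ δ' * L`.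
  obtain ⟨δ, hδ, hδF⟩ : ∃ δ, 0 < δ ∧ 2 * δ = F (q + η) - y :=
    ⟨(F (q + η) - y) / 2, by linarith, by ring⟩
  obtain ⟨δ', hδ', hδF'⟩ : ∃ δ, 0 < δ ∧ 3 * δ = y - F (q - η) :=
    ⟨(y - F (q - η)) / 3, by linarith, by ring⟩
  have hbη := hb.const_mul_atTop hη
  filter_upwards [hupper (q + η) η δ hη hδ, hlower (q - η) η δ' hη hδ',
    hτ.eventually (gt_mem_nhds (by linarith : y < y + δ)),
    hτ.eventually (lt_mem_nhds (by linarith : y - δ' < y)), hL.eventually_gt_atTop 0,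
    hbη.eventually_ge_atTop (Real.log 2), hbη.eventually_ge_atTop (-Real.log δ'),
    hb.eventually_gt_atTop 0] with d h1 h2 h3 h4 h5 h6 h7 h8
  set L := ∑ j ∈ Finset.range d, Lam j
  set θ := Real.exp (-(a d + (q + η + η) * b d)) with hθ
  set θ' := Real.exp (-(a d + (q - η - η) * b d)) with hθ'
  have hθ0 : 0 < θ := Real.exp_pos _
  have hθ0' : 0 < θ' := Real.exp_pos _
  have hSL : largeSum lam d θ ≤ L := by
    rw [hθ, largeSum_exp h0 ℓ]
    exact Finset.sum_le_sum fun j _ => shiftedSum_le h0 hs ℓ j _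
  rw [sub_lt_comm, lt_div_iff₀ h5] at h3
  rw [lt_sub_comm, div_lt_iff₀ h5] at h4
  have hS : 0 < largeSum lam d θ := lt_of_lt_of_le (by
    have : 0 < F (q + η) - δ := by linarith
    positivity) h1
  obtain ⟨h9, h10, h11⟩ := hn d θ hθ0 hS (by
    have h12 : F (q + η) - δ = y + δ := by linarith
    rw [h12] at h1
    linarith)
  have h12 := h11 θ' hθ0'
  have hn0 : (0 : ℝ) < n d := by exact_mod_cast h10
  have hup : Real.log (n d) ≤ Real.log 2 + (Real.log L + (a d + (q + η + η) * b d)) := by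
    have h13 : (n d : ℝ) ≤ 2 * (L / θ) := h9.trans (by gcongr)
    have h14 := Real.log_le_log hn0 h13
    rwa [Real.log_mul two_ne_zero (by positivity), Real.log_div h5.ne' hθ0.ne', hθ,
      Real.log_exp, sub_neg_eq_add] at h14
  have hlow : Real.log δ' + (Real.log L + (a d + (q - η - η) * b d)) ≤ Real.log (n d) := by
    have h13 : δ' * (L / θ') ≤ n d := by
      rw [← mul_div_assoc, div_le_iff₀ hθ0']
      have h14 : F (q - η) + δ' = y - 2 * δ' := by linarith
      rw [h14] at h2
      linarith
    have h14 := Real.log_le_log (by positivity) h13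
    rwa [Real.log_mul hδ'.ne' (by positivity), Real.log_div h5.ne' hθ0'.ne', hθ',
      Real.log_exp, sub_neg_eq_add] at h14
  rw [Real.norm_eq_abs, Real.norm_eq_abs, abs_of_pos h8, abs_le, ← hηc]
  constructor
  · linarith
  · linarith

end Asymp

/-! ### Two-sided complexity bounds for the additive field. -/

section Additive

variable {T : Type*} [MeasureSpace T] [IsProbabilityMeasure (volume : Measure T)]
  {C : ℕ → T → T → ℝ} {r : ℕ → ℝ}
  {K : ℕ → Lp ℝ 2 (volume : Measure T) →L[ℝ] Lp ℝ 2 (volume : Measure T)}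
  {φ : ∀ j, {k // 0 < remEigenvalue (C j) k} → Lp ℝ 2 (volume : Measure T)}

theorem MarginalSpectrum.hasSum_rem {C : T → T → ℝ} {r : ℝ}
    {K : Lp ℝ 2 (volume : Measure T) →L[ℝ] Lp ℝ 2 (volume : Measure T)}
    {φ : {k // 0 < remEigenvalue C k} → Lp ℝ 2 (volume : Measure T)}
    (h : MarginalSpectrum C r K φ) : HasSum (remEigenvalue C) (remTrace C) :=
  h.rem_summable.hasSum

theorem MarginalSpectrum.hasSum_subtype {C : T → T → ℝ} {r : ℝ}
    {K : Lp ℝ 2 (volume : Measure T) →L[ℝ] Lp ℝ 2 (volume : Measure T)}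
    {φ : {k // 0 < remEigenvalue C k} → Lp ℝ 2 (volume : Measure T)}
    (h : MarginalSpectrum C r K φ) {g : ℕ → ℝ} {a : ℝ}
    (hg : HasSum (fun k => remEigenvalue C k * g k) a) :
    HasSum (fun k : {k // 0 < remEigenvalue C k} => remEigenvalue C k * g k) a := by
  refine (hasSum_subtype_iff_of_support_subset (s := {k | 0 < remEigenvalue C k})
    fun k hk => ?_).2 hg
  refine (h.rem_nonneg k).lt_of_ne fun h0 => hk ?_
  simp only [← h0, zero_mul]

variable {d : ℕ} {Ω : Type*} [MeasurableSpace Ω] {P : Measure Ω} [IsProbabilityMeasure P]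
  {Y : (Fin d → T) → Ω → ℝ}

theorem hasSum_additiveVal (hM : ∀ j, MarginalSpectrum (C j) (r j) (K j) (φ j)) :
    HasSum (additiveVal (fun j : Fin d => C j) fun j => r j)
      (∑ j ∈ Finset.range d, trace (C j)) := by
  have h1 : HasSum (fun p : Σ j : Fin d, {k // 0 < remEigenvalue (C j) k} =>
      remEigenvalue (C p.1) p.2) (∑ j : Fin d, remTrace (C j)) :=
    hasSum_sigma_of_nonneg (fun p => p.2.2.le) fun j => by
      simpa using (hM j).hasSum_subtype (g := fun _ => 1) (by simpa using (hM j).hasSum_rem)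
  have h2 : HasSum (additiveVal (fun j : Fin d => C j) fun j => r j) _ :=
    HasSum.sum h1 (hasSum_unique fun _ : Unit => ∑ j : Fin d, r j)
  convert h2 using 1
  rw [Finset.sum_range, ← Finset.sum_add_distrib]
  exact Finset.sum_congr rfl fun j _ => by rw [(hM j).trace_eq, add_comm]

/-- `F` holds the `N` remaining eigenvalues above the threshold and, whatever its size, the
eigenvalue of the constant, whence `N + 1`. -/
theorem exists_finset_largeSum (hM : ∀ j, MarginalSpectrum (C j) (r j) (K j) (φ j)) {θ : ℝ}
    (hθ : 0 < θ) :
    ∃ (N : ℕ) (F : Finset ((Σ j : Fin d, {k // 0 < remEigenvalue (C j) k}) ⊕ Unit)),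
      F.card = N + 1 ∧ N * θ ≤ largeSum (fun j => remEigenvalue (C j)) d θ ∧
      (N = 0 → largeSum (fun j => remEigenvalue (C j)) d θ = 0) ∧
      (∀ i ∉ F, additiveVal (fun j : Fin d => C j) (fun j => r j) i ≤ θ) ∧
      ∑ i ∈ F, additiveVal (fun j : Fin d => C j) (fun j => r j) i =
        largeSum (fun j => remEigenvalue (C j)) d θ + ∑ j ∈ Finset.range d, r j := by
  classical
  let v : (Σ j : Fin d, {k // 0 < remEigenvalue (C j) k}) → ℝ := fun p => remEigenvalue (C p.1) p.2
  have hv : Summable v :=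
    (hasSum_sigma_of_nonneg (fun p => p.2.2.le) fun j => by
      simpa using (hM j).hasSum_subtype (g := fun _ => 1)
        (by simpa using (hM j).hasSum_rem)).summable
  have hfin : {p | θ ≤ v p}.Finite := by
    have := hv.tendsto_cofinite_zero.eventually (gt_mem_nhds hθ)
    rw [Filter.eventually_cofinite] at this
    simpa using this
  let F0 := hfin.toFinset
  have hF0 : ∀ p, p ∈ F0 ↔ θ ≤ v p := fun p => by simp [F0]
  have hsum : ∑ p ∈ F0, v p = largeSum (fun j => remEigenvalue (C j)) d θ := by
    have h1 : HasSum (fun p => v p * (if θ ≤ v p then 1 else 0))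
        (∑ j : Fin d, ∑' k, remEigenvalue (C j) k * (if θ ≤ remEigenvalue (C j) k then 1 else 0)) :=
      hasSum_sigma_of_nonneg (fun p => mul_nonneg p.2.2.le (by split_ifs <;> norm_num)) fun j =>
        (hM j).hasSum_subtype (g := fun k => if θ ≤ remEigenvalue (C j) k then 1 else 0)
          (summable_mul_ite (lam := fun j => remEigenvalue (C j)) (fun j => (hM j).rem_nonneg)
            (fun j => (hM j).hasSum_rem) j _).hasSum
    have h2 : HasSum (fun p => v p * (if θ ≤ v p then 1 else 0))
        (∑ p ∈ F0, v p * (if θ ≤ v p then 1 else 0)) :=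
      hasSum_sum_of_ne_finset_zero fun p hp => by rw [if_neg (by rwa [← hF0]), mul_zero]
    rw [largeSum, Finset.sum_range, h1.unique h2]
    exact Finset.sum_congr rfl fun p hp => by rw [if_pos ((hF0 p).1 hp), mul_one]
  refine ⟨F0.card, F0.disjSum {()}, by simp, ?_, ?_, ?_, ?_⟩
  · rw [← hsum, ← nsmul_eq_mul]
    exact Finset.card_nsmul_le_sum _ _ _ fun p hp => (hF0 p).1 hp
  · intro h0
    rw [← hsum, Finset.card_eq_zero.1 h0, Finset.sum_empty]
  · rintro (p | u) hi
    · have : p ∉ F0 := by simpa using hi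
      rw [hF0, not_le] at this
      exact this.le
    · exact absurd (by simp) hi
  · rw [Finset.sum_disjSum, ← hsum, Finset.sum_range]
    simp [additiveVal, v]

/-- Bounds of the complexity of an additive field in terms of the remaining eigenvalues of the
marginal covariance operators. -/
theorem approxComplexity_bounds
    [TopologicalSpace.SeparableSpace (Lp ℝ 2 (volume : Measure (Fin d → T)))]
    (hM : ∀ j, MarginalSpectrum (C j) (r j) (K j) (φ j)) (hC : ∀ j u, MemLp (C j u) 2 volume)
    (hY : IsField P Y) (hcov : ∀ t s, covFun P Y t s = ∑ j : Fin d, C j (t j) (s j))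
    {ε θ : ℝ} (hε : 0 < ε) (hθ : 0 < θ)
    (hpos : 0 < largeSum (fun j => remEigenvalue (C j)) d θ)
    (hle : ∑ j ∈ Finset.range d, remTrace (C j) - largeSum (fun j => remEigenvalue (C j)) d θ ≤
      ε ^ 2 * ∑ j ∈ Finset.range d, trace (C j)) :
    (approxComplexity P Y ε : ℝ) ≤ 2 * (largeSum (fun j => remEigenvalue (C j)) d θ / θ) ∧
      1 ≤ approxComplexity P Y ε ∧ ∀ θ', 0 < θ' → ∑ j ∈ Finset.range d, remTrace (C j) -
        (largeSum (fun j => remEigenvalue (C j)) d θ' + approxComplexity P Y ε * θ') ≤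
          ε ^ 2 * ∑ j ∈ Finset.range d, trace (C j) := by
  have hspec : FieldSpectrum P Y (additiveVec (C := fun j : Fin d => C j) fun j => φ j)
      (additiveVal (fun j : Fin d => C j) fun j => r j) :=
    fieldSpectrum_additive (fun j => hM j) (fun j => hC j) hY hcov
  have hτ := hspec.hasSum_trace.unique (hasSum_additiveVal hM)
  -- As every `F` contains the constant, `∑ r j` cancels between the trace and the captured sum,
  -- leaving only remaining eigenvalues.
  have htr : ∑ j ∈ Finset.range d, trace (C j) =
      ∑ j ∈ Finset.range d, r j + ∑ j ∈ Finset.range d, remTrace (C j) := by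
    rw [← Finset.sum_add_distrib]
    exact Finset.sum_congr rfl fun j _ => (hM j).trace_eq
  have hτ0 : 0 ≤ ∑ j ∈ Finset.range d, trace (C j) := by
    rw [htr]
    exact add_nonneg (Finset.sum_nonneg fun j _ => (hM j).nonneg)
      (Finset.sum_nonneg fun j _ => tsum_nonneg (hM j).rem_nonneg)
  obtain ⟨N, F, hcard, hN, hN0, hF, hsum⟩ := exists_finset_largeSum (d := d) hM hθ
  have hF0 : F.Nonempty := by rw [← Finset.card_pos]; omega
  obtain ⟨h1, h2, h3⟩ := hspec.approxComplexity_le_card hF0 hε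
    (by rw [hτ, hsum]; linarith)
  refine ⟨?_, h2, fun θ' hθ' => ?_⟩
  -- Positivity of the large sum gives `N ≥ 1`, so `N + 1 ≤ 2 * N`: this is the factor `2`.
  · have h4 : 1 ≤ N := Nat.one_le_iff_ne_zero.2 fun h => hpos.ne' (hN0 h)
    have h5 : (approxComplexity P Y ε : ℝ) ≤ N + 1 := by
      exact_mod_cast hcard ▸ h1
    have h6 : (1 : ℝ) ≤ N := by exact_mod_cast h4
    rw [← le_div_iff₀ hθ] at hN
    linarith
  · obtain ⟨N', F', -, -, -, hF', hsum'⟩ := exists_finset_largeSum (d := d) hM hθ'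
    have h4 := hspec.le_of_approxError_le hθ'.le hF' hε (by rw [hτ]; exact hτ0) h3
    rw [hτ, hsum'] at h4
    linarith

end Additive

/-- The running maximum eventually dominates a fixed positive `lam j 0`, so it cannot be negligible
against bounded partial sums. -/
theorem tendsto_sum_atTop_of_isLittleO {lam : ℕ → ℕ → ℝ} {Lam : ℕ → ℝ}
    (h0 : ∀ j k, 0 ≤ lam j k) (hs : ∀ j, HasSum (lam j) (Lam j)) (ha : ∀ j, Antitone (lam j))
    (hmax : (fun d : ℕ => ⨆ j : Fin d, lam j 0) =o[atTop] fun d : ℕ => ∑ j ∈ Finset.range d, Lam j)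
    (hne : ∃ j, Lam j ≠ 0) : Tendsto (fun d => ∑ j ∈ Finset.range d, Lam j) atTop atTop := by
  have hLam := Lam_nonneg h0 hs
  have hmono : Monotone fun d => ∑ j ∈ Finset.range d, Lam j := fun m n hmn =>
    Finset.sum_le_sum_of_subset_of_nonneg (Finset.range_mono hmn) fun j _ _ => hLam j
  rcases tendsto_atTop_of_monotone hmono with h | ⟨l, hl⟩
  · exact h
  exfalso
  obtain ⟨j, hj⟩ := hne
  have hc : 0 < lam j 0 := by
    refine (h0 j 0).lt_of_ne fun h => hj ?_
    have h1 : lam j = fun _ => 0 := by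
      ext k
      exact le_antisymm ((ha j (Nat.zero_le k)).trans h.symm.le) (h0 j k)
    have h2 := hs j
    rw [h1] at h2
    exact h2.unique hasSum_zero
  have hl0 : 0 ≤ l := (Finset.sum_nonneg fun j _ => hLam j).trans (hmono.ge_of_tendsto hl 0)
  -- With partial sums at most `l`, this constant bounds the maximum by `lam j 0 / 2`; the `+ 1`
  -- keeps the denominator positive.
  have h1 := (isLittleO_iff.1 hmax) (c := lam j 0 / (2 * (l + 1))) (by positivity)
  obtain ⟨d, h2, h3⟩ := (h1.and (eventually_gt_atTop j)).exists
  have h4 : lam j 0 ≤ ⨆ i : Fin d, lam i 0 :=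
    le_ciSup (f := fun i : Fin d => lam i 0) (Set.finite_range _).bddAbove ⟨j, h3⟩
  have h5 : ∑ j ∈ Finset.range d, Lam j ≤ l := hmono.ge_of_tendsto hl d
  have h6 : 0 ≤ ∑ j ∈ Finset.range d, Lam j := Finset.sum_nonneg fun j _ => hLam j
  rw [Real.norm_eq_abs, Real.norm_eq_abs, abs_of_nonneg h6] at h2
  have h7 := (h4.trans (le_abs_self _)).trans h2
  have h8 : lam j 0 / (2 * (l + 1)) * ∑ j ∈ Finset.range d, Lam j ≤ lam j 0 / 2 := by
    rw [div_mul_eq_mul_div, div_le_div_iff₀ (by positivity) two_pos]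
    nlinarith
  linarith

end AdditiveField

/-- Sequences indexed by the positive integers `j` are indexed here from `0`, so that the sum over
`j = 1, …, d` is the sum over `Finset.range d`. -/
theorem mainTheorem3
    -- the marginal processes, zero-mean with continuous covariance functions
    {ΩX : ℕ → Type*} [∀ j, MeasurableSpace (ΩX j)]
    (PX : ∀ j, Measure (ΩX j)) [∀ j, IsProbabilityMeasure (PX j)]
    (X : ∀ j, unitInterval → ΩX j → ℝ)
    (hX : ∀ j, AdditiveField.IsCentered (PX j) (X j))
    (hXcont : ∀ j, Continuous (Function.uncurry (AdditiveField.covFun (PX j) (X j))))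
    -- the additive random fields
    {ΩY : ℕ → Type*} [∀ d, MeasurableSpace (ΩY d)]
    (PY : ∀ d, Measure (ΩY d)) [∀ d, IsProbabilityMeasure (PY d)]
    (Y : ∀ d, (Fin d → unitInterval) → ΩY d → ℝ)
    (hY : ∀ d, AdditiveField.IsCentered (PY d) (Y d))
    (hYmeas : ∀ d, Measurable (Function.uncurry (Y d)))
    (hYcov : ∀ d (t s : Fin d → unitInterval), AdditiveField.covFun (PY d) (Y d) t s =
      ∑ j : Fin d, AdditiveField.covFun (PX j) (X j) (t j) (s j))
    -- the constant function `1` is an eigenvector of each marginal covariance operator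
    (lam₀ : ℕ → ℝ)
    (hone : ∀ j, AdditiveField.EigenEq (AdditiveField.covFun (PX j) (X j)) (lam₀ j) (fun _ => 1))
    -- the remaining eigenvalues of the marginal covariance operators and their sums
    (lam : ℕ → ℕ → ℝ)
    (hlam : ∀ j k, lam j k =
      AdditiveField.remEigenvalue (AdditiveField.covFun (PX j) (X j)) k)
    (Lam : ℕ → ℝ)
    (hLam : ∀ j, Lam j = AdditiveField.remTrace (AdditiveField.covFun (PX j) (X j)))
    -- the two standing assumptions
    (ε₀ : ℝ) (hε₀ : 0 < ε₀) (hε₀' : ε₀ ≤ 1)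
    (hlim : Tendsto (fun d : ℕ => (∑ j ∈ Finset.range d, lam₀ j) /
      ∑ j ∈ Finset.range d, AdditiveField.trace (AdditiveField.covFun (PX j) (X j)))
      atTop (𝓝 (1 - ε₀ ^ 2)))
    (hmax : (fun d : ℕ => ⨆ j : Fin d, lam j 0) =o[atTop]
      fun d : ℕ => ∑ j ∈ Finset.range d, Lam j)
    -- the limit distributions of the eigenvalues and of the weights
    (U : ℝ → ℝ) (hU : AdditiveField.IsDistFun U)
    (ℓ : ℕ → ℝ) (sgn : ℝ) (hsgn : (sgn = 1 ∧ Monotone ℓ) ∨ (sgn = -1 ∧ Antitone ℓ))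
    (hUconv : ∀ x, ContinuousAt U x →
      Tendsto (fun j : ℕ =>
        (1 / Lam j) * ∑' k, lam j k * (if -Real.log (lam j k) - ℓ j ≤ x then 1 else 0))
        atTop (𝓝 (U x)))
    (W : ℝ → ℝ) (hW : AdditiveField.IsDistFun W)
    (a b : ℕ → ℝ) (hbpos : ∀ d, 1 ≤ d → 0 < b d) (hb : Tendsto b atTop atTop)
    (hWconv : ∀ x, ContinuousAt W x →
      Tendsto (fun d : ℕ =>
        (∑ j ∈ Finset.range d, Lam j * (if sgn * (ℓ j - a d) ≤ x * b d then 1 else 0)) /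
          ∑ j ∈ Finset.range d, Lam j)
        atTop (𝓝 (W x)))
    (ε : ℝ) (hε : 0 < ε) (hε' : ε < ε₀)
    (hcont : ContinuousAt (AdditiveField.genInv (AdditiveField.signedDist sgn W))
      (1 - (ε / ε₀) ^ 2)) :
    (fun d : ℕ => Real.log (AdditiveField.approxComplexity (PY d) (Y d) ε : ℝ) -
      (Real.log (∑ j ∈ Finset.range d, Lam j) + a d +
        AdditiveField.genInv (AdditiveField.signedDist sgn W) (1 - (ε / ε₀) ^ 2) * b d))
      =o[atTop] b := by
  obtain rfl : lam = fun j k => AdditiveField.remEigenvalue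
      (AdditiveField.covFun (PX j) (X j)) k := by ext j k; exact hlam j k
  obtain rfl : Lam = fun j => AdditiveField.remTrace (AdditiveField.covFun (PX j) (X j)) := by
    ext j; exact hLam j
  set C : ℕ → unitInterval → unitInterval → ℝ := fun j => AdditiveField.covFun (PX j) (X j)
  choose K φ hM using fun j => AdditiveField.exists_marginalSpectrum (hX j) (hXcont j) (hone j)
  have hM : ∀ j, AdditiveField.MarginalSpectrum (C j) (lam₀ j) (K j) (φ j) := hM
  have hCc : ∀ j, Continuous (Function.uncurry (C j)) := hXcont
  have h0 : ∀ j k, 0 ≤ AdditiveField.remEigenvalue (C j) k := fun j => (hM j).rem_nonneg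
  have hs : ∀ j, HasSum (AdditiveField.remEigenvalue (C j)) (AdditiveField.remTrace (C j)) :=
    fun j => (hM j).hasSum_rem
  -- If every weight vanished, the ratios in `hWconv` would be `0 / 0 = 0`, against `W → 1` at
  -- infinity.
  have hne : ∃ j, AdditiveField.remTrace (C j) ≠ 0 := by
    by_contra! h
    obtain ⟨m, hm⟩ := (hW.tendsto_top.eventually (lt_mem_nhds one_pos)).exists
    obtain ⟨x, hx, -, hc⟩ := AdditiveField.exists_continuousAt_Ioo hW.mono (lt_add_one m)
    have h1 := hWconv x hc
    simp only [show ∀ j, AdditiveField.remTrace (AdditiveField.covFun (PX j) (X j)) = 0 from h,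
      zero_mul, Finset.sum_const_zero, div_zero] at h1
    have h2 := tendsto_nhds_unique h1 tendsto_const_nhds
    linarith [hW.mono hx.le]
  have hL := AdditiveField.tendsto_sum_atTop_of_isLittleO h0 hs (fun j => (hM j).rem_antitone)
    hmax hne
  have hCL : ∀ j u, MemLp (C j u) 2 volume := fun j u => by
    have h1 : Continuous (C j u) := (hCc j).comp (continuous_const.prodMk continuous_id)
    exact (memLp_two_iff_integrable_sq h1.aestronglyMeasurable).2
      ((BoundedContinuousFunction.mkOfCompact ⟨_, h1.pow 2⟩).integrable volume)
  have hF : ∀ d, AdditiveField.IsField (PY d) (Y d) := fun d => by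
    refine ⟨hY d, hYmeas d, ?_⟩
    have h1 : Continuous fun t : Fin d → unitInterval =>
        AdditiveField.covFun (PY d) (Y d) t t := by
      simp only [hYcov]
      exact continuous_finsetSum _ fun j _ => (hCc j).comp
        (g := Function.uncurry (C j)) (f := fun t : Fin d → unitInterval => (t j, t j))
        ((continuous_apply j).prodMk (continuous_apply j))
    exact (BoundedContinuousFunction.mkOfCompact ⟨_, h1⟩).integrable volume
  have htr : ∀ d, ∑ j ∈ Finset.range d, AdditiveField.trace (C j) =
      ∑ j ∈ Finset.range d, lam₀ j + ∑ j ∈ Finset.range d, AdditiveField.remTrace (C j) := by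
    intro d
    rw [← Finset.sum_add_distrib]
    exact Finset.sum_congr rfl fun j _ => (hM j).trace_eq
  -- One minus the ratio in `hlim` is the remaining trace over the full trace, with limit `ε₀ ^ 2 >
  -- 0`; invert it and multiply by `ε ^ 2`.
  have hτ : Tendsto (fun d => 1 - ε ^ 2 * (∑ j ∈ Finset.range d, AdditiveField.trace (C j)) /
      ∑ j ∈ Finset.range d, AdditiveField.remTrace (C j)) atTop (𝓝 (1 - (ε / ε₀) ^ 2)) := by
    have h1 := (((hlim.const_sub 1).inv₀ (by rw [sub_sub_cancel]; positivity)).const_mul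
      (ε ^ 2)).const_sub 1
    rw [sub_sub_cancel, ← div_eq_mul_inv, ← div_pow] at h1
    refine h1.congr' ?_
    filter_upwards [hL.eventually_gt_atTop 0] with d hd
    have h2 : 0 ≤ ∑ j ∈ Finset.range d, lam₀ j := Finset.sum_nonneg fun j _ => (hM j).nonneg
    have h3 := htr d
    have h4 : 0 < ∑ j ∈ Finset.range d, AdditiveField.trace (C j) := by
      rw [h3]; exact add_pos_of_nonneg_of_pos h2 hd
    have h5 : 1 - (∑ j ∈ Finset.range d, lam₀ j) /
        ∑ j ∈ Finset.range d, AdditiveField.trace (C j) =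
        (∑ j ∈ Finset.range d, AdditiveField.remTrace (C j)) /
          ∑ j ∈ Finset.range d, AdditiveField.trace (C j) := by
      rw [one_sub_div h4.ne']
      congr 1
      linarith
    rw [h5, inv_div, mul_div_assoc]
  have hsep : ∀ d, TopologicalSpace.SeparableSpace
      (Lp ℝ 2 (volume : Measure (Fin d → unitInterval))) := fun d => by
    have : Fact ((2 : ℝ≥0∞) ≠ ∞) := ⟨ENNReal.ofNat_ne_top⟩
    have : MeasurableSpace.CountablyGenerated (Fin d → unitInterval) := inferInstance
    have : SecondCountableTopology (Lp ℝ 2 (volume : Measure (Fin d → unitInterval))) :=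
      Lp.SecondCountableTopology
    infer_instance
  have hq : (ε / ε₀) ^ 2 < 1 := by
    have : ε / ε₀ < 1 := (div_lt_one hε₀).2 hε'
    have : 0 < ε / ε₀ := by positivity
    nlinarith
  have hq0 : 0 < (ε / ε₀) ^ 2 := by positivity
  exact AdditiveField.isLittleO_log_complexity h0 hs hU hUconv hL (hsgn.imp And.left And.left) hW
    hb hWconv (by linarith) (by linarith) hτ hcont fun d θ hθ hpos hle =>
      AdditiveField.approxComplexity_bounds hM hCL (hF d) (hYcov d) hε hθ hpos hle
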